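/- Setting. Fix $d$, let $\Omega=\{0,1\}^{\mathbb Z^d}$, $q\in(0,1)$, $p=1-q$, and let $\mu$ be the product measure on $\Omega$ with $\mu(\eta_x=0)=q$, $\mu(\eta_x=1)=p$. For each $x\in\mathbb Z^d$ let $\mathcal C_x$ be a collection of subsets of $\mathbb Z^d$ such that $x\notin A$ for all $A\in\mathcal C_x$, $\mathcal C_x=\mathcal C_0+x$, and, for some $r<\infty$ independent of $x$, every $A\in\mathcal C_x$ is contained in $\{y:1\le \|x-y\|_1\le r\}$. Let $c_x(\omega)=1$ if there is $A\in\mathcal C_x$ with $\omega_y=0$ for all $y\in A$, and $c_x(\omega)=0$ otherwise. Let $(\sigma^\eta(t))_{t\ge0}$ be the càdlàg process on $\Omega$ started from $\eta$ whose generator $\mathcal L$ acts on functions of finitely many spins by $$\mathcal Lf(\omega)=\sum_x c_x(\omega)\bigl(\mu_x(f)(\omega)-f(\omega)\bigr),$$ where $\mu_x(f)$ is the average of $f$ over the spin at $x$ (the solution of the martingale problem for $\mathcal L$ on such functions). Let $\mathrm{Dom}(\mathcal L)$ be the domain of the closure of $\mathcal L$ in $L^2(\mu)$, $\mathcal D(f)=\sum_x\mu(c_x\mathrm{Var}_x(f))$,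 where $\mathrm{Var}_x$ is the variance over the spin at $x$ only, and $$\mathrm{gap}(\mathcal L)=\inf\{\mathcal D(f)/\mathrm{Var}_\mu(f):\ f\in \mathrm{Dom}(\mathcal L),\ \mathrm{Var}_\mu(f)\ne0\}.$$ Let $$F(t)=\int d\mu(\eta)\,\mathbb P(\sigma^\eta_0(s)=\eta_0\ \forall s\le t),\qquad F_i(t)=\int d\mu(\eta)\,\mathbb P(\sigma^\eta_0(s)=i\ \forall s\le t)\quad(i=0,1).$$ Theorem. Assume that $\mathrm{gap}(\mathcal L)\ge\gamma>0$. Then: 1. There is a constant $c>0$ such that $F(t)\le e^{-ct}$ for all $t\ge0$. Moreover $F_1(t)\le \exp\bigl(-t\gamma q/(2(1+p))\bigr)$ for all $t\ge0$. 2. The constant $c$ can be taken proportional to $q\gamma$ as long as $q$ stays away from $1$: for every $q_0<1$ there is $K>0$, depending only on $q_0$ (not on $d$, the classes $\mathcal C_x$, $q$ or $\gamma$), such that whenever $0<q\le q_0$ and $\mathrm{gap}(\mathcal L)\ge\gamma>0$, $$F(t)\le e^{-Kq\gamma t}\quad\text{and}\quad F_0(t)\le e^{-K\gamma t}\qquad\text{for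 all }t\ge0.$$ -/

import Mathlib

open MeasureTheory ProbabilityTheory Filter Topology Set
open scoped NNReal ENNReal unitInterval

noncomputable section

namespace KCSM

/-- The sites of the lattice `ℤ^d`. -/
abbrev Site (d : ℕ) : Type := Fin d → ℤ

/-- The configurations `{0,1}^{ℤ^d}` (`0` = empty, the good state; `1` = occupied), with the
product topology and the product σ-algebra. -/
abbrev Config (d : ℕ) : Type := Site d → Fin 2

/-- The hypotheses on the influence classes `C x`, `x ∈ ℤ^d`. -/
structure IsInfluence {d : ℕ} (C : Site d → Set (Set (Site d))) : Prop where
  /-- independence of `x` -/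
  notMem : ∀ x, ∀ A ∈ C x, x ∉ A
  /-- translation invariance: `C x = C 0 + x` -/
  translation : ∀ x, C x = (fun A : Set (Site d) => (fun y => y + x) '' A) '' C 0
  /-- finite range, for the `ℓ¹` distance -/
  finiteRange : ∃ r : ℕ, ∀ x, ∀ A ∈ C x, ∀ y ∈ A,
    1 ≤ ∑ i, |x i - y i| ∧ ∑ i, |x i - y i| ≤ r

/-- The constraint at `x` is satisfied by `ω`, i.e. `c_x(ω) = 1`. -/
def Constraint {d : ℕ} (C : Site d → Set (Set (Site d))) (x : Site d) (ω : Config d) : Prop :=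
  ∃ A ∈ C x, ∀ y ∈ A, ω y = 0

/-- The single site measure: mass `q` at `0` and mass `p = 1 - q` at `1`. -/
def siteMeasure (q : I) : Measure (Fin 2) := Ber((0 : Fin 2), (1 : Fin 2), q)

/-- The product measure `μ` on configurations. -/
def equilibrium (d : ℕ) (q : I) : Measure (Config d) :=
  Measure.infinitePi fun _ : Site d => siteMeasure q

/-- Functions of finitely many spins. -/
def IsLocal {d : ℕ} (f : Config d → ℝ) : Prop :=
  ∃ Λ : Finset (Site d), DependsOn f (Λ : Set (Site d))

open Classical in
/-- The generator on local functions, `(L f)(ω) = ∑_x c_x(ω) (ν_x(f)(ω) - f(ω))`, where `ν_x`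
averages over the spin at `x`. For local `f` the sum has finitely many non-zero terms. -/
def generator {d : ℕ} (C : Site d → Set (Set (Site d))) (q : I) (f : Config d → ℝ)
    (ω : Config d) : ℝ :=
  ∑' x : Site d, if Constraint C x ω then
    (∫ s, f (Function.update ω x s) ∂(siteMeasure q)) - f ω else 0

/-- `f ∈ Dom(L)`, the domain of the generator in `L²(μ)`, i.e. of the closure in `L²(μ)` of the
generator on local functions. -/
def InDomain {d : ℕ} (C : Site d → Set (Set (Site d))) (q : I) (f : Config d → ℝ) : Prop :=
  MemLp f 2 (equilibrium d q) ∧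
  ∃ g : Config d → ℝ, MemLp g 2 (equilibrium d q) ∧
    ∃ u : ℕ → Config d → ℝ, (∀ n, IsLocal (u n)) ∧
      Tendsto (fun n => eLpNorm (u n - f) 2 (equilibrium d q)) atTop (𝓝 0) ∧
      Tendsto (fun n => eLpNorm (generator C q (u n) - g) 2 (equilibrium d q)) atTop (𝓝 0)

/-- The Dirichlet form `D(f) = ∑_x μ(c_x Var_x(f))`, with values in `[0, ∞]`. -/
def dirichletForm {d : ℕ} (C : Site d → Set (Set (Site d))) (q : I) (f : Config d → ℝ) : ℝ≥0∞ :=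
  ∑' x : Site d, ∫⁻ ω in {ω | Constraint C x ω},
    evariance (fun s => f (Function.update ω x s)) (siteMeasure q) ∂(equilibrium d q)

/-- The spectral gap: the infimum of `D(f) / Var(f)` over the `f ∈ Dom(L)` that are not almost
everywhere constant. -/
def gap {d : ℕ} (C : Site d → Set (Set (Site d))) (q : I) : ℝ≥0∞ :=
  ⨅ (f : Config d → ℝ) (_ : InDomain C q f) (_ : evariance f (equilibrium d q) ≠ 0),
    dirichletForm C q f / evariance f (equilibrium d q)

/-- Càdlàg trajectories `[0,∞) → {0,1}^{ℤ^d}`, with the σ-algebra generated by the coordinates. -/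
abbrev Traj (d : ℕ) : Type :=
  {w : ℝ≥0 → Config d //
    ∀ t, ContinuousWithinAt w (Ici t) t ∧ ∃ l, Tendsto w (𝓝[<] t) (𝓝 l)}

/-- The canonical filtration `ℱ_t = σ(w_s : s ≤ t)`. -/
def canonicalFiltration (d : ℕ) :
    Filtration ℝ≥0 (inferInstance : MeasurableSpace (Traj d)) where
  seq t := ⨆ s : {s : ℝ≥0 // s ≤ t},
    MeasurableSpace.comap (fun w : Traj d => w.1 s.1) inferInstance
  mono' _ t' h := iSup_le fun s =>
    le_iSup (fun s : {s : ℝ≥0 // s ≤ t'} =>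
      MeasurableSpace.comap (fun w : Traj d => w.1 s.1) inferInstance) ⟨s.1, s.2.trans h⟩
  le' _ := iSup_le fun s =>
    ((measurable_pi_apply s.1).comp measurable_subtype_coe).comap_le

/-- `P η` is, for each `η`, the law of the process `(σ_t^η)_{t ≥ 0}` with generator `L` started
from `η`, i.e. the solution of the martingale problem for `L` on local functions. -/
structure IsProcess {d : ℕ} (C : Site d → Set (Set (Site d))) (q : I)
    (P : Kernel (Config d) (Traj d)) : Prop where
  isMarkov : IsMarkovKernel P
  start : ∀ η, ∀ᵐ w ∂(P η), w.1 0 = η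
  martingale : ∀ η, ∀ f : Config d → ℝ, IsLocal f →
    Martingale
      (fun (t : ℝ≥0) (w : Traj d) =>
        f (w.1 t) - ∫ s in (0 : ℝ)..t, generator C q f (w.1 s.toNNReal))
      (canonicalFiltration d) (P η)

/-- The persistence function `F(t) = ∫ dμ(η) ℙ(σ_0^η(s) = η_0 for all s ≤ t)`. -/
def persistence {d : ℕ} (q : I) (P : Kernel (Config d) (Traj d)) (t : ℝ≥0) : ℝ :=
  (∫⁻ η, P η {w | ∀ s ≤ t, w.1 s 0 = η 0} ∂(equilibrium d q)).toReal

/-- `F_i(t) = ∫ dμ(η) ℙ(σ_0^η(s) = i for all s ≤ t)`, for `i = 0, 1`. -/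
def persistenceAt {d : ℕ} (q : I) (P : Kernel (Config d) (Traj d)) (i : Fin 2) (t : ℝ≥0) : ℝ :=
  (∫⁻ η, P η {w | ∀ s ≤ t, w.1 s 0 = i} ∂(equilibrium d q)).toReal

end KCSM

end

noncomputable section

namespace KCSM

variable {d : ℕ}

/-! ### The single site measure -/

/-! Fix a spin value i and let m = μ(η_0 = i). If f vanishes off {η_0 = i}, Cauchy–Schwarz gives
μ(f)² ≤ m μ(f²), so Var(f) ≥ (1 - m) μ(f²), and the spectral gap yields μ(-f Lf) ≥ γ(1 - m) μ(f²)
(`HasRange.gap_mul_sq_le`). The dynamics killed when the origin leaves the value i therefore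
contracts L²(μ) at rate γ(1 - m), and a second use of Cauchy–Schwarz gives F_i(t) ≤ m exp(-γ(1 -
m)t) (`IsProcess.persistenceAt_le_exp`). Every claim follows by taking m = q for i = 0, m = 1 - q
for i = 1, and F ≤ F_0 + F_1.

The killed semigroup is never constructed. An explicit Euler scheme with step h = t/N in a finite
set Λ replaces it, so that only local functions occur and neither a Markov property nor the closure
of the generator is analysed. The scheme inherits the L² decay up to truncation and discretisation
errors (`HasRange.integral_killedScheme_le`), and the martingale problem bounds persistence along
the time grid by the scheme (`IsProcess.measureReal_gridPersist_le`). The truncation error is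
controlled by finite speed of propagation: the single-spin oscillations of the scheme stay below
e^{Mt} 2^{-‖x‖₁}, with M independent of Λ and N (`HasRange.hasOsc_killedScheme`). One lets N → ∞
with Λ fixed, and then Λ exhaust the lattice. -/

instance isProbabilityMeasure_siteMeasure (q : I) : IsProbabilityMeasure (siteMeasure q) := by
  unfold siteMeasure; infer_instance

instance isProbabilityMeasure_equilibrium (q : I) : IsProbabilityMeasure (equilibrium d q) := by
  unfold equilibrium; infer_instance

lemma integral_siteMeasure (q : I) (g : Fin 2 → ℝ) :
    ∫ s, g s ∂(siteMeasure q) = q * g 0 + (1 - q) * g 1 := by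
  unfold siteMeasure
  rw [integral_bernoulliMeasure]
  simp

/-! ### Boxes and local functions -/

/-- The sites at `ℓ^∞`-distance at most `r` from `x`. -/
def box (r : ℕ) (x : Site d) : Finset (Site d) :=
  Finset.Icc (fun i => x i - r) (fun i => x i + r)

lemma mem_box {r : ℕ} {x y : Site d} : y ∈ box r x ↔ ∀ i, x i - r ≤ y i ∧ y i ≤ x i + r := by
  simp [box, Pi.le_def, forall_and]

lemma mem_box_comm {r : ℕ} {x y : Site d} : y ∈ box r x ↔ x ∈ box r y := by
  simp only [mem_box]
  exact forall_congr' fun i => by constructor <;> intro h <;> constructor <;> linarith [h.1, h.2]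

lemma self_mem_box (r : ℕ) (x : Site d) : x ∈ box r x := by
  simp [mem_box]

lemma card_box (r : ℕ) (x : Site d) : (box r x).card = (2 * r + 1) ^ d := by
  simp only [box, Pi.card_Icc, Int.card_Icc]
  rw [Finset.prod_congr rfl (g := fun _ => 2 * r + 1)]
  · simp
  · intro i _; omega

/-- The `r`-neighbourhood of a finite set of sites. -/
def nbhd (r : ℕ) (S : Finset (Site d)) : Finset (Site d) := S.biUnion (box r)

lemma subset_nbhd (r : ℕ) (S : Finset (Site d)) : S ⊆ nbhd r S := fun x hx =>
  Finset.mem_biUnion.2 ⟨x, hx, self_mem_box r x⟩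

lemma box_subset_nbhd {r : ℕ} {S : Finset (Site d)} {x : Site d} (hx : x ∈ S) :
    box r x ⊆ nbhd r S := fun _ hy => Finset.mem_biUnion.2 ⟨x, hx, hy⟩

/-- All sets in `C x` avoid `x` and are contained in the box of radius `r` around `x`. -/
def HasRange (C : Site d → Set (Set (Site d))) (r : ℕ) : Prop :=
  ∀ x, ∀ A ∈ C x, ∀ y ∈ A, y ∈ box r x ∧ y ≠ x

lemma IsInfluence.exists_hasRange {C : Site d → Set (Set (Site d))} (hC : IsInfluence C) :
    ∃ r, HasRange C r := by
  obtain ⟨r, hr⟩ := hC.finiteRange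
  refine ⟨r, fun x A hA y hy => ⟨mem_box.2 fun i => ?_, ?_⟩⟩
  · have h1 := (hr x A hA y hy).2
    have h2 : |x i - y i| ≤ ∑ i, |x i - y i| :=
      Finset.single_le_sum (f := fun i => |x i - y i|) (fun i _ => abs_nonneg _)
        (Finset.mem_univ i)
    have h3 := abs_le.1 (h2.trans h1)
    constructor <;> linarith [h3.1, h3.2]
  · rintro rfl
    exact hC.notMem _ A hA hy

lemma HasRange.constraint_congr {C : Site d → Set (Set (Site d))} {r : ℕ} (hC : HasRange C r)
    {x : Site d} {ω ω' : Config d} (h : ∀ y ∈ box r x, y ≠ x → ω y = ω' y) :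
    Constraint C x ω ↔ Constraint C x ω' := by
  unfold Constraint
  refine exists_congr fun A => and_congr_right fun hA => forall₂_congr fun y hy => ?_
  obtain ⟨h1, h2⟩ := hC x A hA y hy
  rw [h y h1 h2]

lemma HasRange.constraint_update {C : Site d → Set (Set (Site d))} {r : ℕ} (hC : HasRange C r)
    {x y : Site d} (h : x ∉ box r y ∨ x = y) (ω : Config d) (s : Fin 2) :
    Constraint C y (Function.update ω x s) ↔ Constraint C y ω := by
  refine hC.constraint_congr fun z hz hzy => ?_
  rw [Function.update_of_ne]
  rintro rfl
  rcases h with h | h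
  · exact h hz
  · exact hzy h

lemma _root_.DependsOn.apply_update {f : Config d → ℝ} {S : Set (Site d)} (hf : DependsOn f S)
    {x : Site d} (hx : x ∉ S) (ω : Config d) (s : Fin 2) : f (Function.update ω x s) = f ω :=
  hf fun y hy => Function.update_of_ne (fun h : y = x => hx (h ▸ hy)) _ _

lemma measurable_of_dependsOn {f : Config d → ℝ} {S : Finset (Site d)}
    (hf : DependsOn f (S : Set (Site d))) : Measurable f := by
  obtain ⟨g, rfl⟩ := dependsOn_iff_exists_comp.1 hf
  exact (measurable_of_countable g).comp (measurable_pi_lambda _ fun i => measurable_pi_apply _)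

lemma continuous_of_dependsOn {f : Config d → ℝ} {S : Finset (Site d)}
    (hf : DependsOn f (S : Set (Site d))) : Continuous f := by
  obtain ⟨g, rfl⟩ := dependsOn_iff_exists_comp.1 hf
  exact (continuous_of_discreteTopology (f := g)).comp
    (continuous_pi fun i => continuous_apply _)

/-! ### The generator on local functions -/

/-- The average over the spin at `x`. -/
def siteAvg (q : I) (x : Site d) (f : Config d → ℝ) (ω : Config d) : ℝ :=
  q * f (Function.update ω x 0) + (1 - q) * f (Function.update ω x 1)

lemma siteAvg_eq_integral (q : I) (x : Site d) (f : Config d → ℝ) (ω : Config d) :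
    siteAvg q x f ω = ∫ s, f (Function.update ω x s) ∂(siteMeasure q) :=
  (integral_siteMeasure q fun s => f (Function.update ω x s)).symm

open Classical in
/-- The indicator of the constraint at `x`. -/
def rate (C : Site d → Set (Set (Site d))) (x : Site d) (ω : Config d) : ℝ :=
  if Constraint C x ω then 1 else 0

lemma rate_nonneg (C : Site d → Set (Set (Site d))) (x : Site d) (ω : Config d) :
    0 ≤ rate C x ω := by unfold rate; split_ifs <;> norm_num

lemma rate_le_one (C : Site d → Set (Set (Site d))) (x : Site d) (ω : Config d) :
    rate C x ω ≤ 1 := by unfold rate; split_ifs <;> norm_num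

/-- The part of the generator that updates the spin at `x`. -/
def locGen (C : Site d → Set (Set (Site d))) (q : I) (x : Site d) (f : Config d → ℝ)
    (ω : Config d) : ℝ :=
  rate C x ω * (siteAvg q x f ω - f ω)

/-- The generator of the dynamics that updates only the spins in `Λ`. -/
def genOn (C : Site d → Set (Set (Site d))) (q : I) (Λ : Finset (Site d)) (f : Config d → ℝ)
    (ω : Config d) : ℝ :=
  ∑ x ∈ Λ, locGen C q x f ω

lemma generator_eq_tsum (C : Site d → Set (Set (Site d))) (q : I) (f : Config d → ℝ)
    (ω : Config d) : generator C q f ω = ∑' x, locGen C q x f ω := by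
  unfold generator locGen rate
  refine tsum_congr fun x => ?_
  rw [siteAvg_eq_integral]
  split_ifs <;> simp

lemma siteAvg_mem_Icc {q : I} {f : Config d → ℝ} {a b : ℝ} (hf : ∀ ω, f ω ∈ Icc a b)
    (x : Site d) (ω : Config d) : siteAvg q x f ω ∈ Icc a b := by
  unfold siteAvg
  have h0 := hf (Function.update ω x 0)
  have h1 := hf (Function.update ω x 1)
  have hq := q.2.1
  have hq' : 0 ≤ 1 - (q : ℝ) := sub_nonneg.2 q.2.2
  constructor
  · nlinarith [mul_le_mul_of_nonneg_left h0.1 hq, mul_le_mul_of_nonneg_left h1.1 hq']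
  · nlinarith [mul_le_mul_of_nonneg_left h0.2 hq, mul_le_mul_of_nonneg_left h1.2 hq']

lemma locGen_eq_zero {C : Site d → Set (Set (Site d))} {q : I} {f : Config d → ℝ}
    {S : Set (Site d)} (hf : DependsOn f S) {x : Site d} (hx : x ∉ S) (ω : Config d) :
    locGen C q x f ω = 0 := by
  simp only [locGen, siteAvg, hf.apply_update hx]
  ring

lemma generator_eq_genOn {C : Site d → Set (Set (Site d))} {q : I} {f : Config d → ℝ}
    {S : Finset (Site d)} (hf : DependsOn f (S : Set (Site d))) (ω : Config d) :
    generator C q f ω = genOn C q S f ω := by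
  rw [generator_eq_tsum]
  exact tsum_eq_sum fun x hx => locGen_eq_zero hf (by simpa using hx) ω

lemma siteAvg_update_self (q : I) (x : Site d) (f : Config d → ℝ) (ω : Config d) (s : Fin 2) :
    siteAvg q x f (Function.update ω x s) = siteAvg q x f ω := by
  simp [siteAvg]

lemma dependsOn_siteAvg {f : Config d → ℝ} {S : Set (Site d)} (hf : DependsOn f S) (q : I)
    (x : Site d) : DependsOn (siteAvg q x f) S := by
  intro ω ω' h
  have h2 (s : Fin 2) : f (Function.update ω x s) = f (Function.update ω' x s) := by
    refine hf fun y hy => ?_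
    by_cases hyx : y = x
    · subst hyx; simp
    · simp [Function.update_of_ne hyx, h y hy]
  simp only [siteAvg, h2]

lemma HasRange.dependsOn_rate {C : Site d → Set (Set (Site d))} {r : ℕ} (hC : HasRange C r)
    (x : Site d) : DependsOn (rate C x) (box r x : Set (Site d)) := by
  intro ω ω' h
  unfold rate
  rw [hC.constraint_congr fun y hy _ => h y (by simpa using hy)]

lemma HasRange.dependsOn_genOn {C : Site d → Set (Set (Site d))} {r : ℕ} (hC : HasRange C r)
    (q : I) {f : Config d → ℝ} {S Λ : Finset (Site d)} (hf : DependsOn f (S : Set (Site d)))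
    (h : nbhd r Λ ⊆ S) : DependsOn (genOn C q Λ f) (S : Set (Site d)) := by
  intro ω ω' hω
  refine Finset.sum_congr rfl fun x hx => ?_
  have h1 : rate C x ω = rate C x ω' := hC.dependsOn_rate x fun y hy =>
    hω y (h (box_subset_nbhd hx (by simpa using hy)))
  rw [locGen, locGen, h1, dependsOn_siteAvg hf q x hω, hf hω]

lemma HasRange.dependsOn_generator {C : Site d → Set (Set (Site d))} {r : ℕ} (hC : HasRange C r)
    (q : I) {f : Config d → ℝ} {S : Finset (Site d)} (hf : DependsOn f (S : Set (Site d))) :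
    DependsOn (generator C q f) (nbhd r S : Set (Site d)) := by
  have : generator C q f = genOn C q S f := funext fun ω => generator_eq_genOn hf ω
  rw [this]
  exact hC.dependsOn_genOn q (hf.mono (by exact_mod_cast subset_nbhd r S)) le_rfl

lemma abs_locGen_le {C : Site d → Set (Set (Site d))} {q : I} {f : Config d → ℝ} {B : ℝ}
    (hf : ∀ ω, |f ω| ≤ B) (x : Site d) (ω : Config d) : |locGen C q x f ω| ≤ 2 * B := by
  have h1 := siteAvg_mem_Icc (q := q) (fun ω => abs_le.1 (hf ω)) x ω
  have h2 := abs_le.1 (hf ω)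
  rw [locGen, abs_mul, abs_of_nonneg (rate_nonneg C x ω)]
  have h3 : |siteAvg q x f ω - f ω| ≤ 2 * B := abs_le.2 ⟨by linarith [h1.1], by linarith [h1.2]⟩
  calc _ ≤ 1 * |siteAvg q x f ω - f ω| := by gcongr; exact rate_le_one C x ω
    _ ≤ _ := by simpa using h3

lemma abs_genOn_le {C : Site d → Set (Set (Site d))} {q : I} {f : Config d → ℝ} {B : ℝ}
    (hf : ∀ ω, |f ω| ≤ B) (Λ : Finset (Site d)) (ω : Config d) :
    |genOn C q Λ f ω| ≤ Λ.card * (2 * B) := by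
  refine (Finset.abs_sum_le_sum_abs _ _).trans ?_
  rw [← nsmul_eq_mul]
  exact Finset.sum_le_card_nsmul _ _ _ fun x _ => abs_locGen_le hf x ω

/-! ### Oscillations -/

/-- Flipping the spin at `x` changes `f` by at most `b x`. -/
def HasOsc (f : Config d → ℝ) (b : Site d → ℝ) : Prop :=
  ∀ x ω s, |f (Function.update ω x s) - f ω| ≤ b x

lemma HasOsc.nonneg {f : Config d → ℝ} {b : Site d → ℝ} (h : HasOsc f b) (x : Site d) :
    0 ≤ b x := (abs_nonneg _).trans (h x 0 0)

lemma HasOsc.abs_siteAvg_sub_le {f : Config d → ℝ} {b : Site d → ℝ} (h : HasOsc f b) (q : I)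
    (x : Site d) (ω : Config d) : |siteAvg q x f ω - f ω| ≤ b x := by
  have h0 := abs_le.1 (h x ω 0)
  have h1 := abs_le.1 (h x ω 1)
  have hq := q.2.1
  have hq' : 0 ≤ 1 - (q : ℝ) := sub_nonneg.2 q.2.2
  unfold siteAvg
  refine abs_le.2 ⟨?_, ?_⟩
  · nlinarith [mul_le_mul_of_nonneg_left h0.1 hq, mul_le_mul_of_nonneg_left h1.1 hq']
  · nlinarith [mul_le_mul_of_nonneg_left h0.2 hq, mul_le_mul_of_nonneg_left h1.2 hq']

lemma HasOsc.abs_locGen_le {f : Config d → ℝ} {b : Site d → ℝ} (h : HasOsc f b)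
    (C : Site d → Set (Set (Site d))) (q : I) (x : Site d) (ω : Config d) :
    |locGen C q x f ω| ≤ b x := by
  rw [locGen, abs_mul, abs_of_nonneg (rate_nonneg C x ω)]
  calc _ ≤ 1 * b x := by
        gcongr
        · exact rate_le_one C x ω
        · exact h.abs_siteAvg_sub_le q x ω
    _ = b x := one_mul _

/-- One explicit Euler step for the dynamics in `Λ`. -/
def eulerStep (C : Site d → Set (Set (Site d))) (q : I) (Λ : Finset (Site d)) (h : ℝ)
    (f : Config d → ℝ) (ω : Config d) : ℝ :=
  f ω + h * genOn C q Λ f ω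

/-- Discrete maximum principle: since h|Λ| ≤ 1, the step is a convex combination of f ω and the
averages `siteAvg q x f ω`. -/
lemma eulerStep_mem_Icc {C : Site d → Set (Set (Site d))} {q : I} {Λ : Finset (Site d)} {h : ℝ}
    (h0 : 0 ≤ h) (h1 : h * Λ.card ≤ 1) {f : Config d → ℝ} {a b : ℝ} (hf : ∀ ω, f ω ∈ Icc a b)
    (ω : Config d) : eulerStep C q Λ h f ω ∈ Icc a b := by
  have key : ∀ x, rate C x ω * (siteAvg q x f ω - f ω) ∈ Icc (a - f ω) (b - f ω) := fun x => by
    have ha := siteAvg_mem_Icc (q := q) hf x ω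
    have hr0 := rate_nonneg C x ω
    have hr1 := rate_le_one C x ω
    have hfω := hf ω
    constructor
    · nlinarith [mul_le_mul_of_nonneg_left ha.1 hr0, mul_nonneg (sub_nonneg.2 hr1)
        (sub_nonneg.2 hfω.1)]
    · nlinarith [mul_le_mul_of_nonneg_left ha.2 hr0, mul_nonneg (sub_nonneg.2 hr1)
        (sub_nonneg.2 hfω.2)]
  have hlo : Λ.card * (a - f ω) ≤ genOn C q Λ f ω := by
    rw [← nsmul_eq_mul]
    exact Finset.card_nsmul_le_sum _ _ _ fun x _ => (key x).1
  have hhi : genOn C q Λ f ω ≤ Λ.card * (b - f ω) := by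
    rw [← nsmul_eq_mul]
    exact Finset.sum_le_card_nsmul _ _ _ fun x _ => (key x).2
  have hfω := hf ω
  unfold eulerStep
  constructor
  · nlinarith [mul_le_mul_of_nonneg_left hlo h0, mul_nonneg (sub_nonneg.2 h1)
        (sub_nonneg.2 hfω.1)]
  · nlinarith [mul_le_mul_of_nonneg_left hhi h0, mul_nonneg (sub_nonneg.2 h1)
        (sub_nonneg.2 hfω.2)]

/-- The term a is the change of the site average, and e comes from the change of the rate at y,
which needs y within range of x. For y = x neither the rate nor the average sees the flipped spin,
so only the damping of the difference of f remains. -/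
lemma HasRange.locGen_update_sub {C : Site d → Set (Set (Site d))} {r : ℕ} (hC : HasRange C r)
    (q : I) {f : Config d → ℝ} {b : Site d → ℝ} (hf : HasOsc f b) (x y : Site d)
    (ω : Config d) (s : Fin 2) :
    ∃ a e : ℝ, locGen C q y f (Function.update ω x s) - locGen C q y f ω =
        rate C y ω * (a - (f (Function.update ω x s) - f ω)) + e ∧
      |a| ≤ b x ∧ |e| ≤ if y ∈ box r x then b y else 0 := by
  set ω' := Function.update ω x s with hω'
  by_cases hyx : y = x
  · subst hyx
    refine ⟨0, 0, ?_, by simpa using hf.nonneg y, ?_⟩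
    · have hr : rate C y ω' = rate C y ω := by
        unfold rate; rw [hω', hC.constraint_update (Or.inr rfl)]
      rw [locGen, locGen, hr, hω', siteAvg_update_self]
      ring
    · split_ifs <;> simp [hf.nonneg]
  refine ⟨siteAvg q y f ω' - siteAvg q y f ω,
    (rate C y ω' - rate C y ω) * (siteAvg q y f ω' - f ω'), ?_, ?_, ?_⟩
  · rw [locGen, locGen]; ring
  · have hc (t : Fin 2) : Function.update ω' y t =
        Function.update (Function.update ω y t) x s := by
      rw [hω', Function.update_comm (Ne.symm hyx)]
    have h0 := abs_le.1 (hf x (Function.update ω y 0) s)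
    have h1 := abs_le.1 (hf x (Function.update ω y 1) s)
    have hq := q.2.1
    have hq' : 0 ≤ 1 - (q : ℝ) := sub_nonneg.2 q.2.2
    rw [siteAvg, siteAvg, hc, hc]
    refine abs_le.2 ⟨?_, ?_⟩
    · nlinarith [mul_le_mul_of_nonneg_left h0.1 hq, mul_le_mul_of_nonneg_left h1.1 hq']
    · nlinarith [mul_le_mul_of_nonneg_left h0.2 hq, mul_le_mul_of_nonneg_left h1.2 hq']
  · split_ifs with hy
    · rw [abs_mul]
      have h1 : |rate C y ω' - rate C y ω| ≤ 1 := abs_le.2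
        ⟨by linarith [rate_nonneg C y ω', rate_le_one C y ω],
          by linarith [rate_nonneg C y ω, rate_le_one C y ω']⟩
      calc _ ≤ 1 * b y := by
            gcongr
            exact hf.abs_siteAvg_sub_le q y ω'
        _ = b y := one_mul _
    · have hr : rate C y ω' = rate C y ω := by
        unfold rate
        rw [hω', hC.constraint_update (Or.inl fun h => hy (mem_box_comm.1 h))]
      simp [hr]

/-- The damping term and the terms a of `HasRange.locGen_update_sub` balance: (1 - hR) b x + hR b x
= b x, where R is the total rate in Λ. Only the changes of the rates enlarge the oscillation, and
they involve sites near x only, so the growth does not depend on Λ. -/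
lemma HasRange.hasOsc_eulerStep {C : Site d → Set (Set (Site d))} {r : ℕ} (hC : HasRange C r)
    (q : I) {Λ : Finset (Site d)} {h : ℝ} (h0 : 0 ≤ h) (h1 : h * Λ.card ≤ 1)
    {f : Config d → ℝ} {b : Site d → ℝ} (hf : HasOsc f b) :
    HasOsc (eulerStep C q Λ h f) fun x => b x + h * ∑ y ∈ box r x, b y := by
  intro x ω s
  choose a e heq ha he using fun y => hC.locGen_update_sub q hf x y ω s
  set D := f (Function.update ω x s) - f ω with hD
  have hDb : |D| ≤ b x := hf x ω s
  -- Isolating the coefficient 1 - hR of D, which is nonnegative, is what prevents a factor |Λ| in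
  -- the bound.
  have e1 : eulerStep C q Λ h f (Function.update ω x s) - eulerStep C q Λ h f ω =
      (1 - h * ∑ y ∈ Λ, rate C y ω) * D + h * ∑ y ∈ Λ, rate C y ω * a y +
        h * ∑ y ∈ Λ, e y := by
    have : genOn C q Λ f (Function.update ω x s) - genOn C q Λ f ω =
        ∑ y ∈ Λ, rate C y ω * a y - (∑ y ∈ Λ, rate C y ω) * D + ∑ y ∈ Λ, e y := by
      rw [genOn, genOn, ← Finset.sum_sub_distrib, Finset.sum_mul, ← Finset.sum_sub_distrib,
        ← Finset.sum_add_distrib]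
      exact Finset.sum_congr rfl fun y _ => by rw [heq y]; ring
    unfold eulerStep
    linear_combination h * this + hD.symm
  have hR0 : 0 ≤ ∑ y ∈ Λ, rate C y ω := Finset.sum_nonneg fun y _ => rate_nonneg C y ω
  have hR1 : h * ∑ y ∈ Λ, rate C y ω ≤ 1 := by
    refine le_trans (mul_le_mul_of_nonneg_left ?_ h0) h1
    simpa using Finset.sum_le_card_nsmul Λ (fun y => rate C y ω) 1 fun y _ => rate_le_one C y ω
  have hA : |∑ y ∈ Λ, rate C y ω * a y| ≤ (∑ y ∈ Λ, rate C y ω) * b x := by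
    rw [Finset.sum_mul]
    refine (Finset.abs_sum_le_sum_abs _ _).trans (Finset.sum_le_sum fun y _ => ?_)
    rw [abs_mul, abs_of_nonneg (rate_nonneg C y ω)]
    exact mul_le_mul_of_nonneg_left (ha y) (rate_nonneg C y ω)
  have hE : |∑ y ∈ Λ, e y| ≤ ∑ y ∈ box r x, b y := by
    classical
    refine (Finset.abs_sum_le_sum_abs _ _).trans ((Finset.sum_le_sum fun y _ => he y).trans ?_)
    rw [← Finset.sum_filter]
    refine Finset.sum_le_sum_of_subset_of_nonneg (fun y hy => (Finset.mem_filter.1 hy).2)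
      fun y _ _ => hf.nonneg y
  rw [e1]
  refine (abs_add_le _ _).trans (add_le_add ((abs_add_le _ _).trans ?_) ?_)
  · rw [abs_mul, abs_mul, abs_of_nonneg (sub_nonneg.2 hR1), abs_of_nonneg h0]
    nlinarith [mul_le_mul_of_nonneg_left hDb (sub_nonneg.2 hR1), mul_le_mul_of_nonneg_left hA h0]
  · rw [abs_mul, abs_of_nonneg h0]
    exact mul_le_mul_of_nonneg_left hE h0

/-! ### An exponential weight on the lattice -/

/-- The weight `2 ^ (-‖x‖₁)`. -/
def weight (x : Site d) : ℝ := ∏ i, (1 / 2 : ℝ) ^ (x i).natAbs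

lemma weight_pos (x : Site d) : 0 < weight x := Finset.prod_pos fun i _ => by positivity

lemma weight_zero : weight (0 : Site d) = 1 := by simp [weight]

lemma summable_half_pow_natAbs : Summable fun n : ℤ => (1 / 2 : ℝ) ^ n.natAbs := by
  refine Summable.of_nat_of_neg ?_ ?_ <;>
  simpa using summable_geometric_of_lt_one (r := (1 / 2 : ℝ)) (by norm_num) (by norm_num)

/-- The weight is a product over coordinates; any finite set of sites lies in the product of its
coordinate projections, so its sum is at most a product of one-dimensional sums. -/
lemma summable_weight : Summable (weight (d := d)) := by
  classical
  refine summable_of_sum_le (c := ∏ _i : Fin d, ∑' n : ℤ, (1 / 2 : ℝ) ^ n.natAbs)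
    (fun x => (weight_pos x).le) fun s => ?_
  calc ∑ x ∈ s, weight x
      ≤ ∑ x ∈ Fintype.piFinset fun i => s.image fun x => x i, weight x := by
        refine Finset.sum_le_sum_of_subset_of_nonneg (fun x hx => ?_) fun x _ _ => (weight_pos x).le
        exact Fintype.mem_piFinset.2 fun i => Finset.mem_image_of_mem _ hx
    _ = ∏ i, ∑ n ∈ s.image fun x => x i, (1 / 2 : ℝ) ^ n.natAbs := by
        rw [Finset.prod_univ_sum]; rfl
    _ ≤ _ := by
        refine Finset.prod_le_prod (fun i _ => Finset.sum_nonneg fun n _ => by positivity)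
          fun i _ => ?_
        exact summable_half_pow_natAbs.sum_le_tsum _ fun n _ => by positivity

lemma weight_le_of_mem_box {r : ℕ} {x y : Site d} (h : y ∈ box r x) :
    weight y ≤ (2 ^ r) ^ d * weight x := by
  have : ((2 : ℝ) ^ r) ^ d = ∏ _i : Fin d, (2 : ℝ) ^ r := by simp
  rw [this, weight, weight, ← Finset.prod_mul_distrib]
  refine Finset.prod_le_prod (fun i _ => by positivity) fun i _ => ?_
  have hi := mem_box.1 h i
  have : (x i).natAbs ≤ (y i).natAbs + r := by omega
  calc (1 / 2 : ℝ) ^ (y i).natAbs = 2 ^ r * (1 / 2 : ℝ) ^ ((y i).natAbs + r) := by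
        rw [pow_add, mul_left_comm, ← mul_pow]; norm_num
    _ ≤ 2 ^ r * (1 / 2 : ℝ) ^ (x i).natAbs := by
        refine mul_le_mul_of_nonneg_left ?_ (by positivity)
        exact pow_le_pow_of_le_one (by norm_num) (by norm_num) this

/-- This makes the weight a supersolution of the oscillation recursion of
`HasRange.hasOsc_eulerStep`, at the cost of a factor 1 + hM per step. -/
lemma sum_box_weight_le (r : ℕ) (x : Site d) :
    ∑ y ∈ box r x, weight y ≤ (((2 * r + 1) ^ d : ℕ) * (2 ^ r) ^ d : ℝ) * weight x := by
  have := Finset.sum_le_card_nsmul (box r x) weight _ fun y hy => weight_le_of_mem_box hy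
  rwa [card_box, nsmul_eq_mul, ← mul_assoc] at this

/-! ### The killed Euler scheme -/

open Classical in
/-- The indicator of the configurations with spin `i` at the origin. -/
def spinInd (i : Fin 2) (ω : Config d) : ℝ := if ω 0 = i then 1 else 0

/-- The Euler scheme in `Λ` with step `h`, killed when the spin at the origin differs from `i`. -/
def killedScheme (C : Site d → Set (Set (Site d))) (q : I) (Λ : Finset (Site d)) (h : ℝ)
    (i : Fin 2) : ℕ → Config d → ℝ
  | 0 => spinInd i
  | n + 1 => fun ω => spinInd i ω * eulerStep C q Λ h (killedScheme C q Λ h i n) ω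

lemma spinInd_mem_Icc (i : Fin 2) (ω : Config d) : spinInd i ω ∈ Icc (0 : ℝ) 1 := by
  unfold spinInd; split_ifs <;> simp

lemma spinInd_mul_self (i : Fin 2) (ω : Config d) : spinInd i ω * spinInd i ω = spinInd i ω := by
  unfold spinInd; split_ifs <;> simp

lemma dependsOn_spinInd (i : Fin 2) {S : Set (Site d)} (h : 0 ∈ S) :
    DependsOn (spinInd i) S := fun ω ω' hω => by simp [spinInd, hω 0 h]

section scheme

variable {C : Site d → Set (Set (Site d))} {q : I} {Λ : Finset (Site d)} {h : ℝ} {i : Fin 2}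

lemma spinInd_mul_killedScheme (n : ℕ) (ω : Config d) :
    spinInd i ω * killedScheme C q Λ h i n ω = killedScheme C q Λ h i n ω := by
  cases n with
  | zero => exact spinInd_mul_self i ω
  | succ n => rw [killedScheme, ← mul_assoc, spinInd_mul_self]

lemma killedScheme_mem_Icc (h0 : 0 ≤ h) (h1 : h * Λ.card ≤ 1) (n : ℕ) (ω : Config d) :
    killedScheme C q Λ h i n ω ∈ Icc (0 : ℝ) 1 := by
  induction n generalizing ω with
  | zero => exact spinInd_mem_Icc i ω
  | succ n ih =>
    have h2 := eulerStep_mem_Icc (C := C) (q := q) h0 h1 ih ω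
    have h3 := spinInd_mem_Icc i ω
    exact ⟨mul_nonneg h3.1 h2.1, mul_le_one₀ h3.2 h2.1 h2.2⟩

lemma HasRange.dependsOn_killedScheme {r : ℕ} (hC : HasRange C r) (n : ℕ) :
    DependsOn (killedScheme C q Λ h i n) (insert 0 (nbhd r Λ) : Finset (Site d)) := by
  have h0 : (0 : Site d) ∈ ((insert 0 (nbhd r Λ) : Finset (Site d)) : Set (Site d)) := by simp
  induction n with
  | zero => exact dependsOn_spinInd i h0
  | succ n ih =>
    intro ω ω' hω
    have h1 := hC.dependsOn_genOn q ih (Finset.subset_insert 0 (nbhd r Λ)) hω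
    simp only [killedScheme, eulerStep, dependsOn_spinInd i h0 hω, ih hω, h1]

/-- Finite speed of propagation. Away from the origin the killing factor is insensitive to the flip,
and the recursion for the Euler step applies. At the origin it is not, but there the trivial bound 1
for [0,1]-valued functions suffices because the weight equals 1. -/
lemma HasRange.hasOsc_killedScheme {r : ℕ} (hC : HasRange C r) (h0 : 0 ≤ h)
    (h1 : h * Λ.card ≤ 1) (n : ℕ) :
    HasOsc (killedScheme C q Λ h i n) fun x =>
      (1 + h * (((2 * r + 1) ^ d : ℕ) * (2 ^ r) ^ d : ℝ)) ^ n * weight x := by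
  set M : ℝ := ((2 * r + 1) ^ d : ℕ) * (2 ^ r) ^ d with hM
  have hM0 : 0 ≤ M := by positivity
  have hpow (n : ℕ) : 1 ≤ (1 + h * M) ^ n := one_le_pow₀ (by nlinarith)
  have origin (n : ℕ) (ω : Config d) (s : Fin 2) : |killedScheme C q Λ h i n
      (Function.update ω 0 s) - killedScheme C q Λ h i n ω| ≤ (1 + h * M) ^ n * weight (0 : Site d) := by
    have ha := killedScheme_mem_Icc (C := C) (q := q) (i := i) h0 h1 n (Function.update ω 0 s)
    have hb := killedScheme_mem_Icc (C := C) (q := q) (i := i) h0 h1 n ω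
    rw [weight_zero, mul_one]
    exact (abs_le.2 ⟨by linarith [ha.1, hb.2], by linarith [ha.2, hb.1]⟩).trans (hpow n)
  induction n with
  | zero =>
    intro x ω s
    by_cases hx : x = 0
    · subst hx; exact origin 0 ω s
    · have := (dependsOn_spinInd i (mem_singleton (0 : Site d))).apply_update (x := x)
        (by simpa using hx) ω s
      simp [killedScheme, this, (weight_pos x).le]
  | succ n ih =>
    intro x ω s
    by_cases hx : x = 0
    · subst hx; exact origin (n + 1) ω s
    · have e := (dependsOn_spinInd i (mem_singleton (0 : Site d))).apply_update (x := x)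
        (by simpa using hx) ω s
      have h2 := hC.hasOsc_eulerStep q h0 h1 ih x ω s
      have h3 := spinInd_mem_Icc i ω
      simp only [killedScheme, e, ← mul_sub]
      rw [abs_mul, abs_of_nonneg h3.1]
      refine (mul_le_of_le_one_left (abs_nonneg _) h3.2).trans (h2.trans ?_)
      beta_reduce
      rw [← Finset.mul_sum, pow_succ]
      nlinarith [mul_le_mul_of_nonneg_left (sum_box_weight_le r x)
        (mul_nonneg h0 (zero_le_one.trans (hpow n)))]

/-- Only updates outside Λ are missing, and each costs at most the oscillation at its site. The
total is a tail of the summable weight, uniformly in the configuration. -/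
lemma HasRange.abs_generator_sub_genOn_le {r : ℕ} (hC : HasRange C r) (h0 : 0 ≤ h)
    (h1 : h * Λ.card ≤ 1) (n : ℕ) (ω : Config d) :
    |generator C q (killedScheme C q Λ h i n) ω - genOn C q Λ (killedScheme C q Λ h i n) ω| ≤
      Real.exp (n * h * (((2 * r + 1) ^ d : ℕ) * (2 ^ r) ^ d : ℝ)) *
        (∑' x : Site d, weight x - ∑ x ∈ Λ, weight x) := by
  set M : ℝ := ((2 * r + 1) ^ d : ℕ) * (2 ^ r) ^ d with hM
  have hM0 : 0 ≤ M := by positivity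
  have hf : DependsOn (killedScheme C q Λ h i n) (insert 0 (nbhd r Λ) : Finset (Site d)) :=
    hC.dependsOn_killedScheme n
  have hsub : Λ ⊆ insert 0 (nbhd r Λ) := (subset_nbhd r Λ).trans (Finset.subset_insert _ _)
  rw [generator_eq_genOn hf, genOn, genOn, ← Finset.sum_sdiff_eq_sub hsub]
  calc _ ≤ ∑ x ∈ insert 0 (nbhd r Λ) \ Λ, (1 + h * M) ^ n * weight x :=
        (Finset.abs_sum_le_sum_abs _ _).trans (Finset.sum_le_sum fun x _ =>
          (hC.hasOsc_killedScheme h0 h1 n).abs_locGen_le C q x ω)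
    _ = (1 + h * M) ^ n * (∑ x ∈ insert 0 (nbhd r Λ), weight x - ∑ x ∈ Λ, weight x) := by
        rw [← Finset.mul_sum, Finset.sum_sdiff_eq_sub hsub]
    _ ≤ Real.exp (n * h * M) * (∑' x : Site d, weight x - ∑ x ∈ Λ, weight x) := by
        have hs : ∑ x ∈ insert 0 (nbhd r Λ), weight x ≤ ∑' x, weight (d := d) x :=
          summable_weight.sum_le_tsum _ fun x _ => (weight_pos x).le
        have hs' : ∑ x ∈ Λ, weight x ≤ ∑ x ∈ insert 0 (nbhd r Λ), weight x :=
          Finset.sum_le_sum_of_subset_of_nonneg hsub fun x _ _ => (weight_pos x).le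
        refine mul_le_mul ?_ (by linarith) (by linarith) (Real.exp_nonneg _)
        rw [mul_assoc, Real.exp_nat_mul]
        exact pow_le_pow_left₀ (by positivity) (by linarith [Real.add_one_le_exp (h * M)]) n

end scheme

/-! ### Integration of local functions -/

lemma exists_abs_le_of_dependsOn {f : Config d → ℝ} {S : Finset (Site d)}
    (hf : DependsOn f (S : Set (Site d))) : ∃ B, ∀ ω, |f ω| ≤ B := by
  obtain ⟨g, rfl⟩ := dependsOn_iff_exists_comp.1 hf
  obtain ⟨B, hB⟩ := (Set.finite_range fun z => |g z|).bddAbove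
  exact ⟨B, fun ω => hB ⟨_, rfl⟩⟩

lemma memLp_of_dependsOn {f : Config d → ℝ} {S : Finset (Site d)}
    (hf : DependsOn f (S : Set (Site d))) (p : ℝ≥0∞) (μ : Measure (Config d))
    [IsFiniteMeasure μ] : MemLp f p μ := by
  obtain ⟨B, hB⟩ := exists_abs_le_of_dependsOn hf
  exact MemLp.of_bound (measurable_of_dependsOn hf).aestronglyMeasurable B (ae_of_all _ hB)

lemma integrable_of_dependsOn {f : Config d → ℝ} {S : Finset (Site d)}
    (hf : DependsOn f (S : Set (Site d))) (μ : Measure (Config d)) [IsFiniteMeasure μ] :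
    Integrable f μ :=
  memLp_one_iff_integrable.1 (memLp_of_dependsOn hf 1 μ)

lemma measurable_update_prod (x : Site d) :
    Measurable fun z : Config d × Fin 2 => Function.update z.1 x z.2 := by
  refine measurable_pi_lambda _ fun y => ?_
  by_cases h : y = x
  · subst h; simpa using measurable_snd
  · simp only [Function.update_of_ne h]
    exact (measurable_pi_apply y).comp measurable_fst

/-- Resampling one spin from its marginal preserves a product measure; it suffices to compare masses
of finite-dimensional rectangles. -/
lemma map_update_equilibrium (q : I) (x : Site d) :
    ((equilibrium d q).prod (siteMeasure q)).map
      (fun z : Config d × Fin 2 => Function.update z.1 x z.2) = equilibrium d q := by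
  classical
  have hm := measurable_update_prod x
  refine Measure.eq_infinitePi _ fun s t ht => ?_
  rw [Measure.map_apply hm (MeasurableSet.pi s.countable_toSet fun i _ => ht i)]
  have hpre : (fun z : Config d × Fin 2 => Function.update z.1 x z.2) ⁻¹' Set.pi s t =
      Set.pi (s.erase x : Finset (Site d)) t ×ˢ (if x ∈ s then t x else univ) := by
    ext z
    simp only [mem_preimage, Set.mem_pi, Finset.mem_coe, mem_prod, Finset.mem_erase]
    constructor
    · intro h
      refine ⟨fun y hy => by simpa [Function.update_of_ne hy.1] using h y hy.2, ?_⟩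
      split_ifs with hx
      · simpa using h x hx
      · trivial
    · rintro ⟨h1, h2⟩ y hy
      by_cases hyx : y = x
      · subst hyx; simpa [hy] using h2
      · simpa [Function.update_of_ne hyx] using h1 y ⟨hyx, hy⟩
  rw [hpre, Measure.prod_prod, equilibrium, Measure.infinitePi_pi _ fun i _ => ht i]
  split_ifs with hx
  · rw [mul_comm, Finset.mul_prod_erase s (fun y => siteMeasure q (t y)) hx]
  · rw [Finset.erase_eq_of_notMem hx, measure_univ, mul_one]

lemma integral_siteAvg {f : Config d → ℝ} {S : Finset (Site d)}
    (hf : DependsOn f (S : Set (Site d))) (q : I) (x : Site d) :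
    ∫ ω, siteAvg q x f ω ∂(equilibrium d q) = ∫ ω, f ω ∂(equilibrium d q) := by
  have hm := measurable_update_prod x
  have hfm := measurable_of_dependsOn hf
  conv_rhs => rw [← map_update_equilibrium q x]
  rw [integral_map hm.aemeasurable hfm.aestronglyMeasurable, integral_prod]
  · simp only [siteAvg_eq_integral]
  · obtain ⟨B, hB⟩ := exists_abs_le_of_dependsOn hf
    exact Integrable.of_bound (hfm.comp hm).aestronglyMeasurable B (ae_of_all _ fun z => hB _)

lemma _root_.DependsOn.mul_fun {f g : Config d → ℝ} {S : Set (Site d)} (hf : DependsOn f S)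
    (hg : DependsOn g S) : DependsOn (fun ω => f ω * g ω) S := fun ω ω' h => by
  simp only [hf h, hg h]

lemma integral_spinInd (q : I) (i : Fin 2) :
    ∫ ω, spinInd i ω ∂(equilibrium d q) = if i = 0 then (q : ℝ) else 1 - q := by
  have h0 : DependsOn (spinInd i) (({0} : Finset (Site d)) : Set (Site d)) :=
    dependsOn_spinInd i (by simp)
  rw [← integral_siteAvg h0 q 0]
  fin_cases i <;> simp [siteAvg, spinInd]

/-! ### The Dirichlet form of a local function -/

/-- The variance over the spin at `x`. -/
lemma evariance_update (q : I) (x : Site d) (f : Config d → ℝ) (ω : Config d) :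
    evariance (fun s => f (Function.update ω x s)) (siteMeasure q) =
      ENNReal.ofReal (siteAvg q x (fun ω => f ω ^ 2) ω - siteAvg q x f ω ^ 2) := by
  have hL : MemLp (fun s => f (Function.update ω x s)) 2 (siteMeasure q) := MemLp.of_discrete
  rw [← ofReal_variance hL, variance_eq_sub hL, siteAvg_eq_integral, siteAvg_eq_integral]
  rfl

lemma siteAvg_sq_sub_nonneg (q : I) (x : Site d) (f : Config d → ℝ) (ω : Config d) :
    0 ≤ siteAvg q x (fun ω => f ω ^ 2) ω - siteAvg q x f ω ^ 2 := by
  have h : siteAvg q x (fun ω => f ω ^ 2) ω - siteAvg q x f ω ^ 2 =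
      q * (1 - q) * (f (Function.update ω x 0) - f (Function.update ω x 1)) ^ 2 := by
    unfold siteAvg; ring
  rw [h]
  exact mul_nonneg (mul_nonneg q.2.1 (sub_nonneg.2 q.2.2)) (sq_nonneg _)

section form

variable {C : Site d → Set (Set (Site d))} {r : ℕ} {q : I} {f : Config d → ℝ}
  {S : Finset (Site d)}

lemma HasRange.dependsOn_locGen (hC : HasRange C r) (hf : DependsOn f (S : Set (Site d)))
    (x : Site d) : DependsOn (locGen C q x f) (S ∪ box r x : Finset (Site d)) := by
  intro ω ω' h
  have h1 : rate C x ω = rate C x ω' := hC.dependsOn_rate x fun y hy => h y (by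
    simp only [Finset.coe_union]; exact Or.inr hy)
  have h2 : ∀ y ∈ (S : Set (Site d)), ω y = ω' y := fun y hy => h y (by
    simp only [Finset.coe_union]; exact Or.inl hy)
  rw [locGen, locGen, h1, dependsOn_siteAvg hf q x h2, hf h2]

/-- The rate at x does not depend on the spin at x, so averaging -f · `locGen` over that spin gives
the rate times the single-site variance. -/
lemma HasRange.integral_rate_mul_variance (hC : HasRange C r)
    (hf : DependsOn f (S : Set (Site d))) (x : Site d) :
    ∫ ω, rate C x ω * (siteAvg q x (fun ω => f ω ^ 2) ω - siteAvg q x f ω ^ 2)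
      ∂(equilibrium d q) = ∫ ω, -(f ω * locGen C q x f ω) ∂(equilibrium d q) := by
  have h1 : DependsOn (fun ω => -(f ω * locGen C q x f ω))
      ((S ∪ box r x : Finset (Site d)) : Set (Site d)) := by
    intro ω ω' h
    have := (hf.mono (t := ((S ∪ box r x : Finset (Site d)) : Set (Site d)))
      (by simp)).mul_fun (hC.dependsOn_locGen (q := q) hf x) h
    simp only [this]
  rw [← integral_siteAvg h1 q x]
  refine integral_congr_ae (ae_of_all _ fun ω => ?_)
  have hr (s : Fin 2) : rate C x (Function.update ω x s) = rate C x ω := by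
    unfold rate; rw [hC.constraint_update (Or.inr rfl)]
  beta_reduce
  conv_rhs => rw [siteAvg]
  simp only [locGen, hr, siteAvg_update_self]
  simp only [siteAvg]
  ring

lemma HasRange.lintegral_evariance (hC : HasRange C r)
    (hf : DependsOn f (S : Set (Site d))) (x : Site d) :
    ∫⁻ ω in {ω | Constraint C x ω},
      evariance (fun s => f (Function.update ω x s)) (siteMeasure q) ∂(equilibrium d q) =
      ENNReal.ofReal (∫ ω, -(f ω * locGen C q x f ω) ∂(equilibrium d q)) := by
  have hrm : Measurable (rate C x) := measurable_of_dependsOn (hC.dependsOn_rate x)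
  have hset : {ω | Constraint C x ω} = rate C x ⁻¹' {1} := by
    ext ω; simp [rate]
  have hms : MeasurableSet {ω | Constraint C x ω} := by
    rw [hset]; exact hrm (measurableSet_singleton _)
  have hdep : DependsOn (fun ω => rate C x ω *
      (siteAvg q x (fun ω => f ω ^ 2) ω - siteAvg q x f ω ^ 2))
      ((S ∪ box r x : Finset (Site d)) : Set (Site d)) := by
    intro ω ω' h
    have h1 : rate C x ω = rate C x ω' := hC.dependsOn_rate x fun y hy => h y (by
      simp only [Finset.coe_union]; exact Or.inr hy)
    have h2 : ∀ y ∈ (S : Set (Site d)), ω y = ω' y := fun y hy => h y (by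
      simp only [Finset.coe_union]; exact Or.inl hy)
    have h3 : DependsOn (fun ω => f ω ^ 2) (S : Set (Site d)) := fun ω ω' h => by
      simp only [hf h]
    simp only [h1, dependsOn_siteAvg hf q x h2, dependsOn_siteAvg h3 q x h2]
  rw [← hC.integral_rate_mul_variance hf x,
    ofReal_integral_eq_lintegral_ofReal (integrable_of_dependsOn hdep _)
      (ae_of_all _ fun ω => mul_nonneg (rate_nonneg C x ω) (siteAvg_sq_sub_nonneg q x f ω)),
    ← lintegral_indicator hms]
  refine lintegral_congr fun ω => ?_
  by_cases h : Constraint C x ω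
  · rw [indicator_of_mem (by exact h), evariance_update]
    simp [rate, h]
  · rw [indicator_of_notMem (by exact h)]
    simp [rate, h]

lemma HasRange.integral_neg_mul_locGen_nonneg (hC : HasRange C r)
    (hf : DependsOn f (S : Set (Site d))) (x : Site d) :
    0 ≤ ∫ ω, -(f ω * locGen C q x f ω) ∂(equilibrium d q) := by
  rw [← hC.integral_rate_mul_variance hf x]
  exact integral_nonneg fun ω =>
    mul_nonneg (rate_nonneg C x ω) (siteAvg_sq_sub_nonneg q x f ω)

lemma HasRange.integral_neg_mul_generator (hC : HasRange C r)
    (hf : DependsOn f (S : Set (Site d))) :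
    ∫ ω, -(f ω * generator C q f ω) ∂(equilibrium d q) =
      ∑ x ∈ S, ∫ ω, -(f ω * locGen C q x f ω) ∂(equilibrium d q) := by
  rw [← integral_finsetSum]
  · refine integral_congr_ae (ae_of_all _ fun ω => ?_)
    simp only [generator_eq_genOn hf, genOn, Finset.mul_sum, Finset.sum_neg_distrib]
  · intro x _
    refine Integrable.neg (integrable_of_dependsOn ((hf.mono (t := ((S ∪ box r x :
      Finset (Site d)) : Set (Site d))) (by simp)).mul_fun (hC.dependsOn_locGen hf x)) _)

lemma HasRange.dirichletForm_eq (hC : HasRange C r) (hf : DependsOn f (S : Set (Site d))) :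
    dirichletForm C q f =
      ENNReal.ofReal (∫ ω, -(f ω * generator C q f ω) ∂(equilibrium d q)) := by
  rw [hC.integral_neg_mul_generator hf,
    ENNReal.ofReal_sum_of_nonneg fun x _ => hC.integral_neg_mul_locGen_nonneg hf x,
    dirichletForm]
  simp only [hC.lintegral_evariance hf]
  refine tsum_eq_sum fun x hx => ?_
  simp [locGen_eq_zero hf (show x ∉ (S : Set (Site d)) by simpa using hx)]

lemma HasRange.inDomain (hC : HasRange C r) (hf : DependsOn f (S : Set (Site d))) :
    InDomain C q f := by
  refine ⟨memLp_of_dependsOn hf 2 _, generator C q f,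
    memLp_of_dependsOn (hC.dependsOn_generator q hf) 2 _, fun _ => f, fun _ => ⟨S, hf⟩, ?_, ?_⟩
  · simp
  · simp

/-- The Poincaré inequality is needed for local functions only, and these belong to the domain
through a constant approximating sequence. -/
lemma HasRange.gap_mul_variance_le (hC : HasRange C r) (hf : DependsOn f (S : Set (Site d)))
    {γ : ℝ} (hγ : ENNReal.ofReal γ ≤ gap C q) :
    γ * variance f (equilibrium d q) ≤
      ∫ ω, -(f ω * generator C q f ω) ∂(equilibrium d q) := by
  have hE : 0 ≤ ∫ ω, -(f ω * generator C q f ω) ∂(equilibrium d q) := by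
    rw [hC.integral_neg_mul_generator hf]
    exact Finset.sum_nonneg fun x _ => hC.integral_neg_mul_locGen_nonneg hf x
  have hV := ofReal_variance (memLp_of_dependsOn hf 2 (equilibrium d q))
  -- The infimum defining the gap skips functions of zero variance; for them nonnegativity of the
  -- form is enough.
  by_cases h0 : evariance f (equilibrium d q) = 0
  · rw [← hV, ENNReal.ofReal_eq_zero] at h0
    rw [le_antisymm h0 (variance_nonneg _ _), mul_zero]
    exact hE
  · have h1 : ENNReal.ofReal γ ≤ dirichletForm C q f / evariance f (equilibrium d q) :=
      hγ.trans (iInf₂_le_of_le f (hC.inDomain hf) (iInf_le _ h0))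
    have h2 := ENNReal.mul_le_of_le_div h1
    rw [← hV, hC.dirichletForm_eq hf, ← ENNReal.ofReal_mul' (variance_nonneg _ _)] at h2
    exact (ENNReal.ofReal_le_ofReal_iff hE).1 h2

/-! ### Energy estimate for functions supported on one value of the spin at the origin -/

/-- Cauchy–Schwarz against the indicator of {η_0 = i}, obtained by expanding ∫ (f - c 1_i)² ≥ 0 at
the optimal c = μ(f)/m. -/
lemma sq_integral_le_of_spinInd_mul (hf : DependsOn f (S : Set (Site d))) {i : Fin 2}
    (hi : ∀ ω, spinInd i ω * f ω = f ω) {m : ℝ} (hm : 0 < m)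
    (hmi : ∫ ω, spinInd i ω ∂(equilibrium d q) = m) :
    (∫ ω, f ω ∂(equilibrium d q)) ^ 2 ≤ m * ∫ ω, f ω ^ 2 ∂(equilibrium d q) := by
  have hI : DependsOn (spinInd i) (({0} : Finset (Site d)) : Set (Site d)) :=
    dependsOn_spinInd i (by simp)
  have hf2 : DependsOn (fun ω => f ω ^ 2) (S : Set (Site d)) := fun ω ω' h => by
    simp only [hf h]
  have i1 := integrable_of_dependsOn hI (equilibrium d q)
  have i2 := integrable_of_dependsOn hf (equilibrium d q)
  have i3 := integrable_of_dependsOn hf2 (equilibrium d q)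
  set c := (∫ ω, f ω ∂(equilibrium d q)) / m with hc
  have h1 : ∫ ω, (f ω ^ 2 - 2 * c * f ω + c ^ 2 * spinInd i ω) ∂(equilibrium d q) =
      ∫ ω, f ω ^ 2 ∂(equilibrium d q) - 2 * c * ∫ ω, f ω ∂(equilibrium d q) + c ^ 2 * m := by
    have i23 : Integrable (fun ω => f ω ^ 2 - 2 * c * f ω) (equilibrium d q) :=
      i3.sub (i2.const_mul _)
    rw [integral_add i23 (i1.const_mul _),
      integral_sub i3 (i2.const_mul _), integral_const_mul, integral_const_mul,
      hmi]
  have h2 : 0 ≤ ∫ ω, (f ω ^ 2 - 2 * c * f ω + c ^ 2 * spinInd i ω) ∂(equilibrium d q) := by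
    refine integral_nonneg fun ω => ?_
    have e : f ω ^ 2 - 2 * c * f ω + c ^ 2 * spinInd i ω = (f ω - c * spinInd i ω) ^ 2 := by
      linear_combination 2 * c * hi ω - c ^ 2 * spinInd_mul_self i ω
    simp only [e]
    exact sq_nonneg _
  rw [h1] at h2
  have h3 : ∫ ω, f ω ∂(equilibrium d q) = c * m := by rw [hc]; field_simp
  rw [h3] at h2 ⊢
  nlinarith [mul_le_mul_of_nonneg_left h2 hm.le]

/-- A function supported on {η_0 = i} cannot be close to a constant: its variance is at least (1 -
m) μ(f²). This is where the rate γ(1 - m) arises. -/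
lemma HasRange.gap_mul_sq_le (hC : HasRange C r) (hf : DependsOn f (S : Set (Site d)))
    {γ : ℝ} (hγ0 : 0 ≤ γ) (hγ : ENNReal.ofReal γ ≤ gap C q) {i : Fin 2}
    (hi : ∀ ω, spinInd i ω * f ω = f ω) {m : ℝ} (hm : 0 < m)
    (hmi : ∫ ω, spinInd i ω ∂(equilibrium d q) = m) :
    γ * (1 - m) * ∫ ω, f ω ^ 2 ∂(equilibrium d q) ≤
      -∫ ω, f ω * generator C q f ω ∂(equilibrium d q) := by
  have h1 := hC.gap_mul_variance_le hf hγ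
  have h2 := sq_integral_le_of_spinInd_mul hf hi hm hmi
  rw [variance_eq_sub (memLp_of_dependsOn hf 2 _), integral_neg] at h1
  simp only [Pi.pow_apply] at h1
  nlinarith [mul_le_mul_of_nonneg_left h2 hγ0]

/-- Killing only decreases the square. In (f + hG)² = f² + 2h fG + h²G², with G the finite-volume
generator, the cross term is compared with the full generator at cost ε, since the gap controls only
the latter; and |G| ≤ 2|Λ| because 0 ≤ f ≤ 1. -/
lemma HasRange.integral_sq_eulerStep_le (hC : HasRange C r)
    (hf : DependsOn f (S : Set (Site d))) {Λ : Finset (Site d)} (hS : nbhd r Λ ⊆ S)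
    {γ : ℝ} (hγ0 : 0 ≤ γ) (hγ : ENNReal.ofReal γ ≤ gap C q) {i : Fin 2}
    (hi : ∀ ω, spinInd i ω * f ω = f ω) {m : ℝ} (hm : 0 < m)
    (hmi : ∫ ω, spinInd i ω ∂(equilibrium d q) = m) (hf1 : ∀ ω, f ω ∈ Icc (0 : ℝ) 1)
    {ε h : ℝ} (hh : 0 ≤ h) (hε : ∀ ω, |generator C q f ω - genOn C q Λ f ω| ≤ ε) :
    ∫ ω, (spinInd i ω * eulerStep C q Λ h f ω) ^ 2 ∂(equilibrium d q) ≤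
      (1 - 2 * h * (γ * (1 - m))) * ∫ ω, f ω ^ 2 ∂(equilibrium d q) +
        (2 * h * ε + h ^ 2 * (Λ.card * 2) ^ 2) := by
  have hf2 : DependsOn (fun ω => f ω ^ 2) (S : Set (Site d)) := fun ω ω' h => by
    simp only [hf h]
  have hfg : DependsOn (fun ω => f ω * generator C q f ω) (nbhd r S : Set (Site d)) :=
    (hf.mono (by exact_mod_cast subset_nbhd r S)).mul_fun (hC.dependsOn_generator q hf)
  have i1 := integrable_of_dependsOn hf2 (equilibrium d q)
  have i2 := integrable_of_dependsOn hfg (equilibrium d q)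
  have hdep : DependsOn (fun ω => (spinInd i ω * eulerStep C q Λ h f ω) ^ 2)
      ((insert 0 S : Finset (Site d)) : Set (Site d)) := by
    intro ω ω' hω
    have hω' : ∀ x ∈ (S : Set (Site d)), ω x = ω' x := fun x hx => hω x (by simp at hx; simp [hx])
    have e1 := dependsOn_spinInd i (by simp) hω
    have e2 := hC.dependsOn_genOn q hf hS hω'
    simp only [eulerStep, e1, e2, hf hω']
  have i3 := integrable_of_dependsOn hdep (equilibrium d q)
  have hpt : ∀ ω, (spinInd i ω * eulerStep C q Λ h f ω) ^ 2 ≤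
      f ω ^ 2 + 2 * h * (f ω * generator C q f ω) + (2 * h * ε + h ^ 2 * (Λ.card * 2) ^ 2) := by
    intro ω
    have hI := spinInd_mem_Icc i ω
    have h1 : (spinInd i ω * eulerStep C q Λ h f ω) ^ 2 ≤ eulerStep C q Λ h f ω ^ 2 := by
      rw [mul_pow]
      exact mul_le_of_le_one_left (sq_nonneg _) (pow_le_one₀ hI.1 hI.2)
    have h2 : genOn C q Λ f ω ^ 2 ≤ (Λ.card * 2) ^ 2 := by
      have := abs_genOn_le (C := C) (q := q) (f := f) (B := 1) (fun ω => by
        rw [abs_of_nonneg (hf1 ω).1]; exact (hf1 ω).2) Λ ω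
      rw [mul_one] at this
      exact sq_le_sq' (by linarith [(abs_le.1 this).1]) (abs_le.1 this).2
    have h3 : f ω * genOn C q Λ f ω ≤ f ω * generator C q f ω + ε := by
      have h4 := (abs_le.1 (hε ω))
      have h5 := hf1 ω
      have : f ω * (genOn C q Λ f ω - generator C q f ω) ≤ 1 * ε :=
        (mul_le_mul_of_nonneg_left (by linarith) h5.1).trans
          (mul_le_mul_of_nonneg_right h5.2 ((abs_nonneg _).trans (hε ω)))
      linarith
    refine h1.trans ?_
    unfold eulerStep
    nlinarith [mul_le_mul_of_nonneg_left h3 hh, mul_le_mul_of_nonneg_left h2 (sq_nonneg h)]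
  have i12 : Integrable (fun ω => f ω ^ 2 + 2 * h * (f ω * generator C q f ω))
      (equilibrium d q) := i1.add (i2.const_mul _)
  have hint := integral_mono i3 (i12.add (integrable_const
    (2 * h * ε + h ^ 2 * (Λ.card * 2) ^ 2))) hpt
  rw [integral_add' i12 (integrable_const _), integral_add i1 (i2.const_mul _),
    integral_const_mul, integral_const, probReal_univ, one_smul] at hint
  have hg := hC.gap_mul_sq_le hf hγ0 hγ hi hm hmi
  nlinarith [mul_le_mul_of_nonneg_left hg hh]

end form

/-! ### Decay of the killed scheme in L² and in mean -/

section scheme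

variable {C : Site d → Set (Set (Site d))} {q : I} {Λ : Finset (Site d)} {h : ℝ} {i : Fin 2}
  {r : ℕ}

lemma HasRange.integral_sq_killedScheme_le (hC : HasRange C r) {γ : ℝ} (hγ0 : 0 ≤ γ)
    (hγ : ENNReal.ofReal γ ≤ gap C q) {m : ℝ} (hm : 0 < m)
    (hmi : ∫ ω, spinInd i ω ∂(equilibrium d q) = m) (hm1 : m ≤ 1)
    (h0 : 0 ≤ h) (h1 : h * Λ.card ≤ 1) {ε : ℝ} (hε0 : 0 ≤ ε) (N : ℕ)
    (hε : ∀ n < N, ∀ ω, |generator C q (killedScheme C q Λ h i n) ω -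
      genOn C q Λ (killedScheme C q Λ h i n) ω| ≤ ε) :
    ∫ ω, killedScheme C q Λ h i N ω ^ 2 ∂(equilibrium d q) ≤
      Real.exp (-(2 * h * (γ * (1 - m))) * N) * m +
        N * (2 * h * ε + h ^ 2 * (Λ.card * 2) ^ 2) := by
  set κ := 2 * h * (γ * (1 - m)) with hκ
  have hκ0 : 0 ≤ κ := mul_nonneg (by positivity) (mul_nonneg hγ0 (by linarith))
  set R := 2 * h * ε + h ^ 2 * (Λ.card * 2) ^ 2 with hR
  have hR0 : 0 ≤ R := by positivity
  induction N with
  | zero =>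
    simp only [killedScheme, Nat.cast_zero, mul_zero, Real.exp_zero, zero_mul, add_zero, one_mul]
    rw [← hmi]
    refine (integral_congr_ae (ae_of_all _ fun ω => ?_)).le
    simp only [pow_two, spinInd_mul_self]
  | succ N ih =>
    have ih := ih fun n hn => hε n (hn.trans N.lt_succ_self)
    have hstep := hC.integral_sq_eulerStep_le (Λ := Λ)
      (hC.dependsOn_killedScheme (q := q) (Λ := Λ) (h := h) (i := i) N)
      (Finset.subset_insert _ _) hγ0 hγ
      (fun ω => spinInd_mul_killedScheme N ω) hm hmi
      (fun ω => killedScheme_mem_Icc h0 h1 N ω) h0 (hε N N.lt_succ_self)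
    refine hstep.trans ?_
    rw [← hκ, ← hR]
    have hsq : 0 ≤ ∫ ω, killedScheme C q Λ h i N ω ^ 2 ∂(equilibrium d q) :=
      integral_nonneg fun ω => sq_nonneg _
    have h2 : (1 - κ) * ∫ ω, killedScheme C q Λ h i N ω ^ 2 ∂(equilibrium d q) ≤
        Real.exp (-κ) * (Real.exp (-κ * N) * m + N * R) :=
      (mul_le_mul_of_nonneg_right (Real.one_sub_le_exp_neg κ) hsq).trans
        (mul_le_mul_of_nonneg_left ih (Real.exp_nonneg _))
    have h3 : Real.exp (-κ) * (N * R) ≤ N * R :=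
      mul_le_of_le_one_left (by positivity) (Real.exp_le_one_iff.2 (by linarith))
    have h4 : Real.exp (-κ * (N + 1 : ℕ)) = Real.exp (-κ) * Real.exp (-κ * N) := by
      rw [← Real.exp_add]; congr 1; push_cast; ring
    rw [h4]
    push_cast
    linarith

lemma HasRange.integral_killedScheme_le (hC : HasRange C r) {γ : ℝ} (hγ0 : 0 ≤ γ)
    (hγ : ENNReal.ofReal γ ≤ gap C q) {m : ℝ} (hm : 0 < m)
    (hmi : ∫ ω, spinInd i ω ∂(equilibrium d q) = m) (hm1 : m ≤ 1)
    (h0 : 0 ≤ h) (h1 : h * Λ.card ≤ 1) {ε : ℝ} (hε0 : 0 ≤ ε) (N : ℕ)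
    (hε : ∀ n < N, ∀ ω, |generator C q (killedScheme C q Λ h i n) ω -
      genOn C q Λ (killedScheme C q Λ h i n) ω| ≤ ε) :
    ∫ ω, killedScheme C q Λ h i N ω ∂(equilibrium d q) ≤
      m * Real.exp (-(γ * (1 - m) * (N * h))) +
        √(N * (2 * h * ε + h ^ 2 * (Λ.card * 2) ^ 2)) := by
  have h2 := hC.integral_sq_killedScheme_le hγ0 hγ hm hmi hm1 h0 h1 hε0 N hε
  have h3 := sq_integral_le_of_spinInd_mul
    (hC.dependsOn_killedScheme (q := q) (Λ := Λ) (h := h) (i := i) N)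
    (fun ω => spinInd_mul_killedScheme N ω) hm hmi
  set R := N * (2 * h * ε + h ^ 2 * (Λ.card * 2) ^ 2) with hR
  have hR0 : 0 ≤ R := by positivity
  set E := Real.exp (-(γ * (1 - m) * (N * h))) with hE
  have hE2 : Real.exp (-(2 * h * (γ * (1 - m))) * N) = E ^ 2 := by
    rw [hE, ← Real.exp_nat_mul]; congr 1; push_cast; ring
  have hE0 : 0 < E := Real.exp_pos _
  rw [hE2] at h2
  -- The squared mean is at most m(mE² + R), and m ≤ 1 gives m²E² + mR ≤ (mE + √R)².
  refine abs_le_of_sq_le_sq' ?_ (by positivity) |>.2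
  nlinarith [Real.sq_sqrt hR0, Real.sqrt_nonneg R, mul_le_mul_of_nonneg_left h2 hm.le,
    mul_nonneg hm.le (mul_nonneg hE0.le (Real.sqrt_nonneg R)),
    mul_le_mul_of_nonneg_right hm1 hR0]

end scheme

/-! ### Measurability along trajectories -/

lemma measurable_traj_apply (t : ℝ≥0) : Measurable fun w : Traj d => w.1 t :=
  (measurable_pi_apply t).comp measurable_subtype_coe

lemma integrable_apply_traj {g : Config d → ℝ} {T : Finset (Site d)}
    (hg : DependsOn g (T : Set (Site d))) (t : ℝ≥0) (Q : Measure (Traj d)) [IsFiniteMeasure Q] :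
    Integrable (fun w : Traj d => g (w.1 t)) Q := by
  obtain ⟨B, hB⟩ := exists_abs_le_of_dependsOn hg
  exact Integrable.of_bound ((measurable_of_dependsOn hg).comp
    (measurable_traj_apply t)).aestronglyMeasurable B (ae_of_all _ fun w => hB _)

/-- The smallest point of the grid `(n + 1)⁻¹ ℕ` that is larger than `t`. -/
def gridSucc (n : ℕ) (t : ℝ≥0) : ℝ≥0 := ((⌊t * (n + 1)⌋₊ : ℝ≥0) + 1) / (n + 1)

lemma le_gridSucc (n : ℕ) (t : ℝ≥0) : t ≤ gridSucc n t := by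
  unfold gridSucc
  rw [le_div_iff₀ (by positivity)]
  exact (Nat.lt_floor_add_one _).le

lemma gridSucc_le (n : ℕ) (t : ℝ≥0) : gridSucc n t ≤ t + 1 / (n + 1) := by
  unfold gridSucc
  rw [add_div]
  gcongr
  rw [div_le_iff₀ (by positivity)]
  exact Nat.floor_le (by positivity)

lemma tendsto_gridSucc (t : ℝ≥0) : Tendsto (fun n => gridSucc n t) atTop (𝓝[≥] t) := by
  refine tendsto_nhdsWithin_iff.2 ⟨?_, Eventually.of_forall fun n => le_gridSucc n t⟩
  refine tendsto_of_tendsto_of_tendsto_of_le_of_le tendsto_const_nhds ?_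
    (fun n => le_gridSucc n t) (fun n => gridSucc_le n t)
  simpa using (tendsto_const_nhds (x := t)).add
    (tendsto_one_div_add_atTop_nhds_zero_nat (𝕜 := ℝ≥0))

/-- By right-continuity, evaluation at t is the limit of evaluations at grid times to the right of
t; for each mesh only countably many times occur. -/
lemma measurable_apply_traj_prod {g : Config d → ℝ} (hg : Measurable g) (hc : Continuous g) :
    Measurable fun z : ℝ × Traj d => g (z.2.1 z.1.toNNReal) := by
  refine measurable_of_tendsto_metrizable (f := fun n (z : ℝ × Traj d) =>
    g (z.2.1 (gridSucc n z.1.toNNReal))) (fun n => ?_) ?_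
  · have h1 : Measurable fun z : ℕ × Traj d => g (z.2.1 (((z.1 : ℝ≥0) + 1) / (n + 1))) :=
      measurable_from_prod_countable_right fun k =>
        hg.comp (measurable_traj_apply (((k : ℝ≥0) + 1) / (n + 1)))
    have h2 : Measurable fun z : ℝ × Traj d => (⌊z.1.toNNReal * (n + 1)⌋₊, z.2) :=
      (Nat.measurable_floor.comp ((measurable_fst.real_toNNReal).mul_const _)).prodMk
        measurable_snd
    exact h1.comp h2
  · rw [tendsto_pi_nhds]
    intro z
    exact (hc.tendsto _).comp (((z.2.2 z.1.toNNReal).1).tendsto.comp (tendsto_gridSucc _))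

/-! ### The martingale problem over a short time -/

section process

variable {C : Site d → Set (Set (Site d))} {q : I} {P : Kernel (Config d) (Traj d)} {r : ℕ}
  {f : Config d → ℝ} {S : Finset (Site d)}

/-- Dynkin's formula restricted to an event E of the past at time s. Allowing such E is what
replaces the Markov property later on. -/
lemma IsProcess.setIntegral_sub (hP : IsProcess C q P) (hC : HasRange C r) (η : Config d)
    (hf : DependsOn f (S : Set (Site d))) {s u : ℝ≥0} (hsu : s ≤ u) {E : Set (Traj d)}
    (hE : MeasurableSet[canonicalFiltration d s] E) :
    ∫ w in E, f (w.1 u) ∂(P η) - ∫ w in E, f (w.1 s) ∂(P η) =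
      ∫ a in (s : ℝ)..u, ∫ w in E, generator C q f (w.1 a.toNNReal) ∂(P η) := by
  have := hP.isMarkov
  have hg := hC.dependsOn_generator q hf
  obtain ⟨B, hB⟩ := exists_abs_le_of_dependsOn hg
  have hjm : Measurable fun z : ℝ × Traj d => generator C q f (z.2.1 z.1.toNNReal) :=
    measurable_apply_traj_prod (measurable_of_dependsOn hg) (continuous_of_dependsOn hg)
  have hii (w : Traj d) (a b : ℝ) :
      IntervalIntegrable (fun t => generator C q f (w.1 t.toNNReal)) volume a b := by
    rw [intervalIntegrable_iff]
    have : IsFiniteMeasure (volume.restrict (uIoc a b)) := ⟨by simp [uIoc]⟩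
    exact Integrable.of_bound (hjm.comp measurable_prodMk_right).aestronglyMeasurable B
      (ae_of_all _ fun t => hB _)
  have hfi (t : ℝ≥0) : Integrable (fun w : Traj d => f (w.1 t)) ((P η).restrict E) :=
    integrable_apply_traj hf t _
  have hM := hP.martingale η f ⟨S, hf⟩
  have hMi (t : ℝ≥0) := (hM.integrable t).restrict (s := E)
  have hIi (t : ℝ≥0) : Integrable (fun w : Traj d =>
      ∫ a in (0 : ℝ)..t, generator C q f (w.1 a.toNNReal)) ((P η).restrict E) := by
    refine ((hfi t).sub (hMi t)).congr (ae_of_all _ fun w => ?_)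
    simp
  have h1 := hM.setIntegral_eq hsu hE
  rw [integral_sub (hfi s) (hIi s), integral_sub (hfi u) (hIi u)] at h1
  have h2 : ∫ w in E, (∫ a in (s : ℝ)..u, generator C q f (w.1 a.toNNReal)) ∂(P η) =
      ∫ w in E, (∫ a in (0 : ℝ)..u, generator C q f (w.1 a.toNNReal)) ∂(P η) -
        ∫ w in E, (∫ a in (0 : ℝ)..s, generator C q f (w.1 a.toNNReal)) ∂(P η) := by
    rw [← integral_sub (hIi u) (hIi s)]
    refine integral_congr_ae (ae_of_all _ fun w => ?_)
    exact (intervalIntegral.integral_interval_sub_left (hii w _ _) (hii w _ _)).symm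
  have h3 : ∫ a in (s : ℝ)..u, ∫ w in E, generator C q f (w.1 a.toNNReal) ∂(P η) =
      ∫ w in E, (∫ a in (s : ℝ)..u, generator C q f (w.1 a.toNNReal)) ∂(P η) := by
    refine intervalIntegral_integral_swap ?_
    have : IsFiniteMeasure (volume.restrict (uIoc (s : ℝ) u)) := ⟨by simp [uIoc]⟩
    exact Integrable.of_bound hjm.aestronglyMeasurable B (ae_of_all _ fun t => hB _)
  rw [h3, h2]
  linarith

/-- A Taylor bound of second order: `IsProcess.setIntegral_sub` is applied to f, and then to
`generator C q f` to show that its integral over E moves by at most hB during the step. -/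
lemma IsProcess.setIntegral_le_euler (hP : IsProcess C q P) (hC : HasRange C r) (η : Config d)
    (hf : DependsOn f (S : Set (Site d))) {s h : ℝ≥0} {E : Set (Traj d)}
    (hE : MeasurableSet[canonicalFiltration d s] E) {B : ℝ}
    (hB : ∀ ω, |generator C q (generator C q f) ω| ≤ B) :
    ∫ w in E, f (w.1 (s + h)) ∂(P η) ≤
      ∫ w in E, (f (w.1 s) + h * generator C q f (w.1 s)) ∂(P η) + h ^ 2 * B := by
  have := hP.isMarkov
  have hg := hC.dependsOn_generator q hf
  have hB0 : 0 ≤ B := (abs_nonneg _).trans (hB 0)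
  have h1 := hP.setIntegral_sub hC η hf (le_self_add (a := s) (b := h)) hE
  have hmass : ∀ g : Traj d → ℝ, (∀ w, |g w| ≤ B) → |∫ w in E, g w ∂(P η)| ≤ B := by
    intro g hg
    have h := norm_setIntegral_le_of_norm_le_const (μ := P η) (s := E) (f := g) (C := B)
      (measure_lt_top _ _) fun w _ => hg w
    exact h.trans (mul_le_of_le_one_right hB0 measureReal_le_one)
  have h2 : ∀ a ∈ Icc (s : ℝ) (s + h : ℝ≥0),
      ∫ w in E, generator C q f (w.1 a.toNNReal) ∂(P η) ≤
        ∫ w in E, generator C q f (w.1 s) ∂(P η) + h * B := by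
    intro a ha
    have hsa : s ≤ a.toNNReal := by
      rw [← NNReal.coe_le_coe, Real.coe_toNNReal _ (s.2.trans ha.1)]; exact ha.1
    have h3 := hP.setIntegral_sub hC η hg hsa hE
    have h4 : |∫ b in (s : ℝ)..a.toNNReal,
        ∫ w in E, generator C q (generator C q f) (w.1 b.toNNReal) ∂(P η)| ≤
          B * |(a.toNNReal : ℝ) - s| := by
      rw [← Real.norm_eq_abs (∫ b in (s : ℝ)..a.toNNReal, _)]
      exact intervalIntegral.norm_integral_le_of_norm_le_const fun b _ => hmass _ fun w => hB _
    rw [← h3] at h4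
    have h5 : |(a.toNNReal : ℝ) - s| ≤ h := by
      rw [Real.coe_toNNReal _ (s.2.trans ha.1), abs_of_nonneg (by linarith [ha.1])]
      have := ha.2; push_cast at this; linarith
    have h6 := (abs_le.1 (h4.trans (mul_le_mul_of_nonneg_left h5 hB0))).2
    linarith
  have hcont : IntervalIntegrable
      (fun a : ℝ => ∫ w in E, generator C q f (w.1 a.toNNReal) ∂(P η)) volume s
        (s + h : ℝ≥0) := by
    obtain ⟨B', hB'⟩ := exists_abs_le_of_dependsOn hg
    have hjm : Measurable fun z : ℝ × Traj d => generator C q f (z.2.1 z.1.toNNReal) :=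
      measurable_apply_traj_prod (measurable_of_dependsOn hg) (continuous_of_dependsOn hg)
    rw [intervalIntegrable_iff]
    have : IsFiniteMeasure (volume.restrict (uIoc (s : ℝ) (s + h : ℝ≥0))) := ⟨by simp [uIoc]⟩
    exact (Integrable.of_bound hjm.aestronglyMeasurable B'
      (ae_of_all _ fun t => hB' _)).integral_prod_left
  have h7 : ∫ a in (s : ℝ)..(s + h : ℝ≥0),
      ∫ w in E, generator C q f (w.1 a.toNNReal) ∂(P η) ≤
        h * (∫ w in E, generator C q f (w.1 s) ∂(P η) + h * B) := by
    have := intervalIntegral.integral_mono_on (μ := volume) (by simp) hcont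
      (intervalIntegrable_const (c := ∫ w in E, generator C q f (w.1 s) ∂(P η) + h * B)) h2
    rwa [intervalIntegral.integral_const, smul_eq_mul,
      show ((s + h : ℝ≥0) : ℝ) - s = h by push_cast; ring] at this
  rw [integral_add (integrable_apply_traj hf s _) ((integrable_apply_traj hg s _).const_mul _), integral_const_mul]
  linarith

/-! ### Persistence along a grid -/

/-- The trajectories with spin `i` at the origin at the times `0, h, …, k h`. -/
def gridPersist (d : ℕ) (i : Fin 2) (h : ℝ≥0) (k : ℕ) : Set (Traj d) :=
  {w | ∀ j ≤ k, w.1 (j * h) 0 = i}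

lemma measurableSet_gridPersist (i : Fin 2) (h : ℝ≥0) (k : ℕ) :
    MeasurableSet[canonicalFiltration d (k * h)] (gridPersist d i h k) := by
  have : gridPersist d i h k = ⋂ j : {j : ℕ // j ≤ k}, {w | w.1 (j.1 * h) 0 = i} := by
    ext w; simp [gridPersist]
  rw [this]
  refine MeasurableSet.iInter fun j => ?_
  have hj : (j.1 : ℝ≥0) * h ≤ k * h := by gcongr; exact j.2
  refine le_iSup (fun s : {s : ℝ≥0 // s ≤ k * h} =>
    MeasurableSpace.comap (fun w : Traj d => w.1 s.1) inferInstance) ⟨j.1 * h, hj⟩ _ ?_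
  exact ⟨{ω | ω 0 = i}, (measurable_pi_apply (0 : Site d) : Measurable fun ω : Config d => ω 0)
    (measurableSet_singleton i), rfl⟩

variable {Λ : Finset (Site d)} {i : Fin 2}

/-- The check at time (k + 1)h may be dropped because the scheme is nonnegative and, beyond its
initial stage, does its own killing. After the Euler step, the check at time kh supplies the factor
`spinInd` that turns the step into stage n + 1. -/
lemma IsProcess.setIntegral_killedScheme_le (hP : IsProcess C q P) (hC : HasRange C r)
    (η : Config d) {h : ℝ≥0} (h1 : h * Λ.card ≤ (1 : ℝ)) {ε B : ℝ} {n : ℕ}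
    (hε : ∀ ω, |generator C q (killedScheme C q Λ h i n) ω -
      genOn C q Λ (killedScheme C q Λ h i n) ω| ≤ ε)
    (hB : ∀ ω, |generator C q (generator C q (killedScheme C q Λ h i n)) ω| ≤ B) (k : ℕ) :
    ∫ w in gridPersist d i h (k + 1), killedScheme C q Λ h i n (w.1 ((k + 1 : ℕ) * h)) ∂(P η) ≤
      ∫ w in gridPersist d i h k, killedScheme C q Λ h i (n + 1) (w.1 (k * h)) ∂(P η) +
        h * (ε + h * B) := by
  have := hP.isMarkov
  have h0 : (0 : ℝ) ≤ h := h.2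
  have hdep (n : ℕ) : DependsOn (killedScheme C q Λ h i n) _ := hC.dependsOn_killedScheme n
  have hgen := hC.dependsOn_generator q (hdep n)
  have hmeas (k : ℕ) : MeasurableSet (gridPersist d i h k) :=
    (canonicalFiltration d).le _ _ (measurableSet_gridPersist i h k)
  have hε0 : 0 ≤ ε := (abs_nonneg _).trans (hε 0)
  have e : ((k + 1 : ℕ) : ℝ≥0) * h = k * h + h := by push_cast; ring
  calc _ ≤ ∫ w in gridPersist d i h k, killedScheme C q Λ h i n (w.1 (k * h + h)) ∂(P η) := by
        rw [e]
        exact setIntegral_mono_set (integrable_apply_traj (hdep n) _ _)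
          (ae_of_all _ fun w => (killedScheme_mem_Icc h0 h1 n _).1)
          (LE.le.eventuallyLE fun w hw j hj => hw j (hj.trans k.le_succ))
    _ ≤ ∫ w in gridPersist d i h k, (killedScheme C q Λ h i n (w.1 (k * h)) +
          h * generator C q (killedScheme C q Λ h i n) (w.1 (k * h))) ∂(P η) + h ^ 2 * B :=
        hP.setIntegral_le_euler hC η (hdep n) (measurableSet_gridPersist i h k) hB
    _ ≤ ∫ w in gridPersist d i h k,
          (killedScheme C q Λ h i (n + 1) (w.1 (k * h)) + h * ε) ∂(P η) + h ^ 2 * B := by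
        refine add_le_add ?_ le_rfl
        refine setIntegral_mono_on ((integrable_apply_traj (hdep n) _ _).add ((integrable_apply_traj hgen _ _).const_mul _))
          ((integrable_apply_traj (hdep (n + 1)) _ ((P η).restrict _)).add
            (integrable_const (h * ε : ℝ))) (hmeas k) fun w hw => ?_
        have hw0 : spinInd i (w.1 (k * h)) = 1 := by simp [spinInd, hw k le_rfl]
        have := (abs_le.1 (hε (w.1 (k * h)))).2
        simp only [killedScheme, eulerStep, hw0, one_mul]
        nlinarith [mul_le_mul_of_nonneg_left this h0]
    _ ≤ _ := by
        rw [integral_add (integrable_apply_traj (hdep (n + 1)) _ _) (integrable_const _), setIntegral_const,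
          smul_eq_mul]
        have : (P η).real (gridPersist d i h k) * (h * ε) ≤ h * ε :=
          mul_le_of_le_one_left (by positivity) measureReal_le_one
        nlinarith

lemma IsProcess.measureReal_gridPersist_le (hP : IsProcess C q P) (hC : HasRange C r)
    (η : Config d) {h : ℝ≥0} (h1 : h * Λ.card ≤ (1 : ℝ)) {ε B : ℝ} (N : ℕ)
    (hε : ∀ n < N, ∀ ω, |generator C q (killedScheme C q Λ h i n) ω -
      genOn C q Λ (killedScheme C q Λ h i n) ω| ≤ ε)
    (hB : ∀ n < N, ∀ ω, |generator C q (generator C q (killedScheme C q Λ h i n)) ω| ≤ B) :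
    (P η).real (gridPersist d i h N) ≤
      killedScheme C q Λ h i N η + N * (h * (ε + h * B)) := by
  have := hP.isMarkov
  have h0 : (0 : ℝ) ≤ h := h.2
  -- Here n counts the time steps already absorbed into the scheme and k those still imposed on the
  -- trajectory; each induction step trades one for the other until k = 0.
  have key : ∀ n ≤ N, ∀ k, (P η).real (gridPersist d i h (n + k)) ≤
      ∫ w in gridPersist d i h k, killedScheme C q Λ h i n (w.1 (k * h)) ∂(P η) +
        n * (h * (ε + h * B)) := by
    intro n
    induction n with
    | zero =>
      intro _ k
      have hm : MeasurableSet (gridPersist d i h k) :=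
        (canonicalFiltration d).le _ _ (measurableSet_gridPersist i h k)
      have : ∫ w in gridPersist d i h k, killedScheme C q Λ h i 0 (w.1 (k * h)) ∂(P η) =
          ∫ w in gridPersist d i h k, (1 : ℝ) ∂(P η) :=
        setIntegral_congr_fun hm fun w hw => by simp [killedScheme, spinInd, hw k le_rfl]
      rw [this]
      simp
    | succ n ih =>
      intro hn k
      have h2 := ih (by omega) (k + 1)
      have h3 := hP.setIntegral_killedScheme_le hC η h1 (hε n hn) (hB n hn) k
      rw [show n + 1 + k = n + (k + 1) by ring]
      refine h2.trans ?_
      push_cast at h3 ⊢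
      linarith
  have h4 := key N le_rfl 0
  have hdep : DependsOn (killedScheme C q Λ h i N) _ := hC.dependsOn_killedScheme N
  have h5 : ∫ w in gridPersist d i h 0, killedScheme C q Λ h i N (w.1 (0 * h)) ∂(P η) ≤
      killedScheme C q Λ h i N η := by
    calc _ ≤ ∫ w, killedScheme C q Λ h i N (w.1 (0 * h)) ∂(P η) :=
          setIntegral_le_integral (integrable_apply_traj hdep _ _)
            (ae_of_all _ fun w => (killedScheme_mem_Icc h0 h1 N _).1)
      _ = ∫ w, killedScheme C q Λ h i N η ∂(P η) := by
          refine integral_congr_ae ?_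
          filter_upwards [hP.start η] with w hw
          simp [hw]
      _ = _ := by simp
  simp only [add_zero, Nat.cast_zero] at h4
  linarith

end process

/-! ### The persistence functions -/

lemma measurableSet_persist (i : Fin 2) (t : ℝ≥0) :
    MeasurableSet {w : Traj d | ∀ s ≤ t, w.1 s 0 = i} := by
  -- Right-continuity reduces times s < t to rational ones, but t itself cannot be approached from
  -- the right within [0, t]; capping the times by `min` includes it.
  have : {w : Traj d | ∀ s ≤ t, w.1 s 0 = i} =
      ⋂ a : ℚ, {w | w.1 (min (a : ℝ).toNNReal t) 0 = i} := by
    ext w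
    simp only [mem_ofPred_eq, mem_iInter]
    refine ⟨fun h a => h _ (min_le_right _ _), fun h s hs => ?_⟩
    rcases hs.eq_or_lt with rfl | hs
    · obtain ⟨a, ha⟩ := exists_rat_gt (s : ℝ)
      have := h a
      rwa [min_eq_right (NNReal.le_toNNReal_of_coe_le ha.le)] at this
    · have hc : Tendsto (fun u => w.1 u 0) (𝓝[≥] s) (𝓝 (w.1 s 0)) :=
        ((continuous_apply (0 : Site d)).tendsto _).comp (w.2 s).1.tendsto
      have h1 : ∀ᶠ u in 𝓝[>] s, w.1 u 0 = w.1 s 0 :=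
        (hc.mono_left (nhdsWithin_mono _ Ioi_subset_Ici_self)).eventually
          (eventually_of_mem (by simp) fun x (hx : x ∈ ({w.1 s 0} : Set (Fin 2))) => hx)
      obtain ⟨b, hb, hsub⟩ := (mem_nhdsGT_iff_exists_Ioo_subset' hs).1 h1
      obtain ⟨a, ha1, ha2⟩ := exists_rat_btwn (NNReal.coe_lt_coe.2 (lt_min hb hs))
      have ha0 : (0 : ℝ) ≤ a := s.2.trans ha1.le
      have h2 : s < (a : ℝ).toNNReal := by
        rwa [← NNReal.coe_lt_coe, Real.coe_toNNReal _ ha0]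
      have h3 : (a : ℝ).toNNReal < min b t := by
        rwa [← NNReal.coe_lt_coe, Real.coe_toNNReal _ ha0]
      rw [← hsub ⟨h2, h3.trans_le (min_le_left _ _)⟩]
      have := h a
      rwa [min_eq_left (h3.le.trans (min_le_right _ _))] at this
  rw [this]
  refine MeasurableSet.iInter fun a => ?_
  exact ((measurable_pi_apply (0 : Site d) : Measurable fun ω : Config d => ω 0).comp
    (measurable_traj_apply _)) (measurableSet_singleton i)

section process

variable {C : Site d → Set (Set (Site d))} {q : I} {P : Kernel (Config d) (Traj d)}

lemma persistence_le_add (hP : IsMarkovKernel P) (t : ℝ≥0) :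
    persistence q P t ≤ persistenceAt q P 0 t + persistenceAt q P 1 t := by
  have hfin (i : Fin 2) : ∫⁻ η, P η {w | ∀ s ≤ t, w.1 s 0 = i} ∂(equilibrium d q) ≠ ∞ := by
    refine ne_top_of_le_ne_top (b := 1) ENNReal.one_ne_top ?_
    calc _ ≤ ∫⁻ _, 1 ∂(equilibrium d q) := lintegral_mono fun η => prob_le_one
      _ = 1 := by simp
  unfold persistence persistenceAt
  rw [← ENNReal.toReal_add (hfin 0) (hfin 1),
    ← lintegral_add_left (P.measurable_coe (measurableSet_persist 0 t))]
  refine ENNReal.toReal_mono ?_ (lintegral_mono fun η => ?_)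
  · rw [lintegral_add_left (P.measurable_coe (measurableSet_persist 0 t))]
    exact ENNReal.add_ne_top.2 ⟨hfin 0, hfin 1⟩
  · obtain h | h : η 0 = 0 ∨ η 0 = 1 := by
      generalize η 0 = a; fin_cases a <;> simp
    · simp only [h]; exact le_self_add
    · simp only [h]; exact le_add_self

variable {r : ℕ} {i : Fin 2} {γ m : ℝ}

/-- K and B may depend on Λ and t but not on N, so the discretisation errors vanish as N → ∞ while
the truncation error ε stays fixed. -/
lemma IsProcess.persistenceAt_le_grid (hP : IsProcess C q P) (hC : HasRange C r) (hγ0 : 0 ≤ γ)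
    (hγ : ENNReal.ofReal γ ≤ gap C q) (hm : 0 < m)
    (hmi : ∫ ω, spinInd i ω ∂(equilibrium d q) = m) (hm1 : m ≤ 1) (t : ℝ≥0)
    (Λ : Finset (Site d)) {ε : ℝ}
    (hε : Real.exp (t * (((2 * r + 1) ^ d : ℕ) * (2 ^ r) ^ d : ℝ)) *
        (∑' x : Site d, weight x - ∑ x ∈ Λ, weight x) = ε) :
    ∃ K B : ℝ, ∀ N : ℕ, 0 < N → (t / N : ℝ) * Λ.card ≤ 1 → persistenceAt q P i t ≤
      m * Real.exp (-(γ * (1 - m) * t)) + √(t * (2 * ε + t / N * K)) +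
        t * (ε + t / N * B) := by
  have := hP.isMarkov
  have htail : 0 ≤ ∑' x : Site d, weight x - ∑ x ∈ Λ, weight x :=
    sub_nonneg.2 (summable_weight.sum_le_tsum _ fun x _ => (weight_pos x).le)
  have hε0 : 0 ≤ ε := hε ▸ mul_nonneg (Real.exp_nonneg _) htail
  set S : Finset (Site d) := insert 0 (nbhd r Λ) with hS
  set B : ℝ := (nbhd r S).card * (2 * (S.card * (2 * 1))) with hBdef
  have hB0 : 0 ≤ B := by positivity
  -- K comes from the quadratic term of the Euler step in L²; B bounds the twice-applied generator
  -- on [0,1]-valued functions depending on S.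
  refine ⟨(Λ.card * 2) ^ 2, B, fun N hN h1 => ?_⟩
  set h : ℝ≥0 := t / N with hh
  have hN' : (N : ℝ) ≠ 0 := by positivity
  have hcoe : (h : ℝ) = t / N := by rw [hh]; push_cast; rfl
  have hNh : (N : ℝ) * h = t := by rw [hcoe]; field_simp
  rw [← hcoe] at h1 ⊢
  have h0 : (0 : ℝ) ≤ h := h.2
  have hdep (n : ℕ) : DependsOn (killedScheme C q Λ h i n) (S : Set (Site d)) :=
    hC.dependsOn_killedScheme n
  have herr : ∀ n < N, ∀ ω, |generator C q (killedScheme C q Λ h i n) ω -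
      genOn C q Λ (killedScheme C q Λ h i n) ω| ≤ ε := by
    intro n hn ω
    refine (hC.abs_generator_sub_genOn_le h0 h1 n ω).trans ?_
    rw [← hε]
    refine mul_le_mul_of_nonneg_right (Real.exp_le_exp.2 ?_) htail
    refine mul_le_mul_of_nonneg_right ?_ (by positivity)
    rw [← hNh]
    gcongr
  have hgen2 : ∀ n < N, ∀ ω,
      |generator C q (generator C q (killedScheme C q Λ h i n)) ω| ≤ B := by
    intro n _ ω
    rw [generator_eq_genOn (hC.dependsOn_generator q (hdep n))]
    refine abs_genOn_le (fun ω => ?_) _ ω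
    rw [generator_eq_genOn (hdep n)]
    refine abs_genOn_le (fun ω => ?_) _ ω
    have := killedScheme_mem_Icc (C := C) (q := q) (i := i) h0 h1 n ω
    rw [abs_of_nonneg this.1]
    exact this.2
  have hpt : ∀ η, P η {w | ∀ s ≤ t, w.1 s 0 = i} ≤
      ENNReal.ofReal (killedScheme C q Λ h i N η + t * (ε + h * B)) := by
    intro η
    have hsub : {w : Traj d | ∀ s ≤ t, w.1 s 0 = i} ⊆ gridPersist d i h N := by
      intro w hw j hj
      refine hw _ ?_
      rw [← NNReal.coe_le_coe, ← hNh]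
      push_cast
      gcongr
    have h2 := hP.measureReal_gridPersist_le hC η h1 N herr hgen2
    rw [← mul_assoc, hNh] at h2
    refine (measure_mono hsub).trans ?_
    rw [← ofReal_measureReal]
    exact ENNReal.ofReal_le_ofReal h2
  have hw0 (η : Config d) : 0 ≤ killedScheme C q Λ h i N η + t * (ε + h * B) :=
    add_nonneg (killedScheme_mem_Icc h0 h1 N η).1 (by positivity)
  have hint := integrable_of_dependsOn (hdep N) (equilibrium d q)
  have hF : persistenceAt q P i t ≤
      ∫ η, (killedScheme C q Λ h i N η + t * (ε + h * B)) ∂(equilibrium d q) := by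
    refine ENNReal.toReal_le_of_le_ofReal (integral_nonneg hw0) ?_
    have hi : Integrable (fun η => killedScheme C q Λ h i N η + t * (ε + h * B))
        (equilibrium d q) := hint.add (integrable_const _)
    rw [ofReal_integral_eq_lintegral_ofReal hi (ae_of_all _ hw0)]
    exact lintegral_mono hpt
  rw [integral_add hint (integrable_const _), integral_const, probReal_univ, one_smul] at hF
  have hI := hC.integral_killedScheme_le hγ0 hγ hm hmi hm1 h0 h1 hε0 N herr
  rw [hNh] at hI
  have e : (N : ℝ) * (2 * h * ε + h ^ 2 * (Λ.card * 2) ^ 2) =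
      t * (2 * ε + h * (Λ.card * 2) ^ 2) := by rw [← hNh]; ring
  rw [e] at hI
  linarith

lemma IsProcess.persistenceAt_le_exp (hP : IsProcess C q P) (hC : HasRange C r) (hγ0 : 0 ≤ γ)
    (hγ : ENNReal.ofReal γ ≤ gap C q) (hm : 0 < m)
    (hmi : ∫ ω, spinInd i ω ∂(equilibrium d q) = m) (hm1 : m ≤ 1) (t : ℝ≥0) :
    persistenceAt q P i t ≤ m * Real.exp (-(γ * (1 - m) * t)) := by
  set G := Real.exp (t * (((2 * r + 1) ^ d : ℕ) * (2 ^ r) ^ d : ℝ)) with hG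
  have h1 (Λ : Finset (Site d)) : persistenceAt q P i t ≤
      m * Real.exp (-(γ * (1 - m) * t)) +
        √(t * (2 * (G * (∑' x : Site d, weight x - ∑ x ∈ Λ, weight x)))) +
        t * (G * (∑' x : Site d, weight x - ∑ x ∈ Λ, weight x)) := by
    obtain ⟨K, B, h⟩ := hP.persistenceAt_le_grid hC hγ0 hγ hm hmi hm1 t Λ rfl
    set ε := G * (∑' x : Site d, weight x - ∑ x ∈ Λ, weight x) with hε
    have hlim : Tendsto (fun N : ℕ => (t / N : ℝ)) atTop (𝓝 0) :=
      tendsto_const_div_atTop_nhds_zero_nat _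
    have hcont : Continuous fun x : ℝ => m * Real.exp (-(γ * (1 - m) * t)) +
        √(t * (2 * ε + x * K)) + t * (ε + x * B) := by fun_prop
    have hT := (hcont.tendsto 0).comp hlim
    simp only [zero_mul, add_zero] at hT
    refine ge_of_tendsto hT ?_
    have hs : ∀ᶠ N : ℕ in atTop, (t / N : ℝ) * Λ.card < 1 :=
      (hlim.mul_const (Λ.card : ℝ)).eventually_lt_const (by simp)
    filter_upwards [hs, eventually_gt_atTop 0] with N hN hN0
    exact h N hN0 hN.le
  have hlim : Tendsto (fun Λ : Finset (Site d) => ∑' x : Site d, weight x - ∑ x ∈ Λ, weight x)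
      atTop (𝓝 0) := by
    simpa using (tendsto_const_nhds (x := ∑' x : Site d, weight x)).sub
      (summable_weight (d := d)).hasSum
  have hcont : Continuous fun x : ℝ => m * Real.exp (-(γ * (1 - m) * t)) +
      √(t * (2 * (G * x))) + t * (G * x) := by fun_prop
  have hT := (hcont.tendsto 0).comp hlim
  simp only [mul_zero, Real.sqrt_zero, add_zero] at hT
  exact ge_of_tendsto hT (Eventually.of_forall h1)

lemma IsProcess.persistenceAt_zero_le (hP : IsProcess C q P) (hC : IsInfluence C)
    (hq : (0 : ℝ) < q) (hγ0 : 0 ≤ γ) (hγ : ENNReal.ofReal γ ≤ gap C q) (t : ℝ≥0) :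
    persistenceAt q P 0 t ≤ q * Real.exp (-(γ * (1 - q) * t)) := by
  obtain ⟨r, hr⟩ := hC.exists_hasRange
  exact hP.persistenceAt_le_exp hr hγ0 hγ hq (by simp [integral_spinInd]) q.2.2 t

lemma IsProcess.persistenceAt_one_le (hP : IsProcess C q P) (hC : IsInfluence C)
    (hq : (q : ℝ) < 1) (hγ0 : 0 ≤ γ) (hγ : ENNReal.ofReal γ ≤ gap C q) (t : ℝ≥0) :
    persistenceAt q P 1 t ≤ (1 - q) * Real.exp (-(γ * q * t)) := by
  obtain ⟨r, hr⟩ := hC.exists_hasRange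
  have := hP.persistenceAt_le_exp hr hγ0 hγ (sub_pos.2 hq) (i := 1)
    (by simp [integral_spinInd]) (by linarith [q.2.1]) t
  rwa [sub_sub_cancel] at this

/-- The prefactors q and 1 - q of the two bounds add up to 1, so no constant appears in front of the
exponential. -/
lemma IsProcess.persistence_le (hP : IsProcess C q P) (hC : IsInfluence C)
    (hq0 : (0 : ℝ) < q) (hq1 : (q : ℝ) < 1) (hγ0 : 0 ≤ γ) (hγ : ENNReal.ofReal γ ≤ gap C q)
    {c : ℝ} (hc0 : c ≤ γ * (1 - q)) (hc1 : c ≤ γ * q) (t : ℝ≥0) :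
    persistence q P t ≤ Real.exp (-(c * t)) := by
  have h0 := hP.persistenceAt_zero_le hC hq0 hγ0 hγ t
  have h1 := hP.persistenceAt_one_le hC hq1 hγ0 hγ t
  have e0 : Real.exp (-(γ * (1 - q) * t)) ≤ Real.exp (-(c * t)) := by gcongr
  have e1 : Real.exp (-(γ * q * t)) ≤ Real.exp (-(c * t)) := by gcongr
  have := persistence_le_add (q := q) hP.isMarkov t
  nlinarith [mul_le_mul_of_nonneg_left e0 hq0.le,
    mul_le_mul_of_nonneg_left e1 (sub_pos.2 hq1).le]

end process

end KCSM

end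

theorem mainTheorem3 :
    (∀ (d : ℕ) (C : KCSM.Site d → Set (Set (KCSM.Site d))) (q : unitInterval) (γ : ℝ)
        (P : ProbabilityTheory.Kernel (KCSM.Config d) (KCSM.Traj d)),
        KCSM.IsInfluence C → (0 : ℝ) < q → (q : ℝ) < 1 → KCSM.IsProcess C q P →
        0 < γ → ENNReal.ofReal γ ≤ KCSM.gap C q →
        (∃ c : ℝ, 0 < c ∧ ∀ t : NNReal, KCSM.persistence q P t ≤ Real.exp (-(c * t))) ∧
        (∀ t : NNReal, KCSM.persistenceAt q P 1 t ≤
          Real.exp (-(t * γ * q / (2 * (1 + (1 - (q : ℝ)))))))) ∧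
    (∀ q₀ : ℝ, q₀ < 1 → ∃ K : ℝ, 0 < K ∧
      ∀ (d : ℕ) (C : KCSM.Site d → Set (Set (KCSM.Site d))) (q : unitInterval) (γ : ℝ)
        (P : ProbabilityTheory.Kernel (KCSM.Config d) (KCSM.Traj d)),
        KCSM.IsInfluence C → (0 : ℝ) < q → (q : ℝ) ≤ q₀ → KCSM.IsProcess C q P →
        0 < γ → ENNReal.ofReal γ ≤ KCSM.gap C q →
        ∀ t : NNReal,
          KCSM.persistence q P t ≤ Real.exp (-(K * (q * γ) * t)) ∧
          KCSM.persistenceAt q P 0 t ≤ Real.exp (-(K * γ * t))) := by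
  refine ⟨fun d C q γ P hC hq0 hq1 hP hγ0 hγ => ⟨?_, fun t => ?_⟩, fun q₀ hq₀ => ?_⟩
  · exact ⟨min (γ * (1 - q)) (γ * q),
      lt_min (mul_pos hγ0 (sub_pos.2 hq1)) (mul_pos hγ0 hq0), fun t =>
      hP.persistence_le hC hq0 hq1 hγ0.le hγ (min_le_left _ _) (min_le_right _ _) t⟩
  · refine (hP.persistenceAt_one_le hC hq1 hγ0.le hγ t).trans ?_
    refine (mul_le_of_le_one_left (Real.exp_nonneg _) (by linarith)).trans ?_
    -- The rate γq already obtained beats the claimed one, since 2(1 + p) ≥ 1.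
    refine Real.exp_le_exp.2 (neg_le_neg ?_)
    have h0 : 0 ≤ t * γ * q := by positivity
    rw [show γ * q * t = t * γ * q by ring]
    exact div_le_self h0 (by linarith)
  -- The bound 1 - q₀ ≤ 1 - q serves the rate γ(1 - q) of F_0, and K ≤ 1 serves the rate γq of F_1.
  -- The minimum with 1 also covers q₀ < 0, where the claim is vacuous.
  · refine ⟨min 1 (1 - q₀), lt_min one_pos (sub_pos.2 hq₀),
      fun d C q γ P hC hq0 hq1 hP hγ0 hγ t => ?_⟩
    have hq1' : (q : ℝ) < 1 := hq1.trans_lt hq₀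
    have hK0 : 0 ≤ min 1 (1 - q₀) := (lt_min one_pos (sub_pos.2 hq₀)).le
    have hK : min 1 (1 - q₀) * γ ≤ γ * (1 - q) := by
      rw [mul_comm]
      exact mul_le_mul_of_nonneg_left ((min_le_right _ _).trans (by linarith)) hγ0.le
    refine ⟨hP.persistence_le hC hq0 hq1' hγ0.le hγ ?_ ?_ t, ?_⟩
    · refine le_trans ?_ hK
      exact mul_le_mul_of_nonneg_left (mul_le_of_le_one_left hγ0.le hq1'.le) hK0
    · rw [mul_comm γ]
      exact mul_le_of_le_one_left (mul_nonneg hq0.le hγ0.le) (min_le_left _ _)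
    · refine (hP.persistenceAt_zero_le hC hq0 hγ0.le hγ t).trans ?_
      refine (mul_le_of_le_one_left (Real.exp_nonneg _) hq1'.le).trans ?_
      exact Real.exp_le_exp.2 (neg_le_neg (mul_le_mul_of_nonneg_right hK t.2))
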